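/- **Setting.** Let $\bar f_0:\mathbb R^n\to\mathbb R$ and $\bar c_I:\mathbb R^n\to\mathbb R^q$ be the true objective and constraint functions, with gradient $\bar g_0=\nabla\bar f_0$ and Jacobian $\bar J_I$, and let $f_0,g_0,c_I,J_I$ be noisy versions of $\bar f_0,\bar g_0,\bar c_I,\bar J_I$. All norms are Euclidean norms or induced 2-norms. Fix $\mu>0$. For $z=(x,s)\in\mathbb R^n\times\mathbb R^q$ with $s>0$ and $S=\mathrm{diag}(s)$, put $$f(z)=f_0(x)-\mu\sum_i\log s^{(i)},\quad c(z)=c_I(x)+s,\quad g(z)=\begin{bmatrix}g_0(x)\\-\mu e\end{bmatrix},\quad J(z)=[J_I(x)\ \ S],$$ where $e=(1,\dots,1)^T$, and define $\bar f,\bar c,\bar g,\bar J$ in the same way from the true functions. A subscript $k$ means evaluation at $z_k=(x_k,s_k)$. The merit function is $\phi(z,\tau)=\tau f(z)+\|c(z)\|$, and the model reductions are $\Delta m_k(d,\tau)=-\tau g_k^Td+\|c_k\|-\|c_k+J_kd\|$ and $\Delta\bar m_k(d,\tau)=-\tau\bar g_k^Td+\|\bar c_k\|-\|\bar c_k+\bar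 J_kd\|$. **Algorithm.** Input: $x_0$, $s_0>0$ with $c(z_0)\ge0$, and parameters $\epsilon_f,\epsilon_c,\tau_{-1},\omega,\zeta>0$ and $\sigma,\delta_\tau,\eta_s,\eta_\phi\in(0,1)$. In iteration $k=0,1,\dots$: 1. stop if $J_k^Tc_k=0$ and $c_I(x_k)\not\le0$; 2. let $v_k$ minimize $\frac12\|c_k+J_kv\|^2$ over $v\in\mathrm{range}(J_k^T)$ with $\|v\|\le\omega\|J_k^Tc_k\|$; 3. choose $W_k=\mathrm{diag}(H_k,\Sigma_k)$ with $H_k\in\mathbb R^{n\times n}$ symmetric and $\Sigma_k\in\mathbb R^{q\times q}$ diagonal and positive definite, and let $(d_k,y_{k+1})$ solve $W_kd_k+J_k^Ty_{k+1}=-g_k$, $J_kd_k=J_kv_k$; set $u_k=d_k-v_k$ and $d_k=(d_k^x,d_k^s)$; 4. stop if $J_k^Tc_k=0$ and $g_k+J_k^Ty_{k+1}=0$; 5. let $\tau_k^{\rm trial}=\infty$ if $g_k^Td_k+\frac12u_k^TW_ku_k\le0$, and $\tau_k^{\rm trial}=\frac{(1-\sigma)(\|c_k\|-\|c_k+J_kv_k\|)}{g_k^Td_k+\frac12u_k^TW_ku_k}$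 otherwise; set $\tau_k=\tau_{k-1}$ if $\tau_{k-1}\le\tau_k^{\rm trial}$, and $\tau_k=\min\{(1-\delta_\tau)\tau_{k-1},\tau_k^{\rm trial}\}$ otherwise; 6. let $\alpha_k^{\max}$ be the largest $\alpha\in(0,1]$ with $s_k+\alpha S_kd_k^s\ge(1-\eta_s)s_k$, and let $\alpha_k=2^{-j}\alpha_k^{\max}$ with the least $j\in\{0,1,\dots\}$ for which $\alpha=2^{-j}\alpha_k^{\max}$ satisfies $$\phi\big((x_k+\alpha d_k^x,\;s_k+\alpha S_kd_k^s),\tau_k\big)\le\phi(z_k,\tau_k)-\eta_\phi\alpha\Delta m_k(d_k,\tau_k)+(2+\zeta)\varepsilon_k,\qquad\varepsilon_k:=\tau_k\epsilon_f+\epsilon_c;$$ 7. set $x_{k+1}=x_k+\alpha_kd_k^x$ and $s_{k+1}=\max\{s_k+\alpha_kS_kd_k^s,-c_I(x_{k+1})\}$ componentwise. Let $\bar v_k,\bar d_k,\bar y_{k+1},\bar u_k=\bar d_k-\bar v_k$ and $\bar\tau_k$ (with $\bar\tau_{-1}=\tau_{-1}$) be the values obtained along the same iterates $z_k$ and with the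 same $W_k$ when the noiseless $\bar c_k,\bar J_k,\bar g_k$ are used in steps 2, 3 and 5. **Assumptions.** * (A1, data and noise) There is an open convex set $\mathcal X\subseteq\mathbb R^n$ that contains all iterates $x_k$ and all first trial points $x_k+\alpha_k^{\max}d_k^x$. On $\mathcal X$, $\bar f_0$ and $\bar c_I$ are continuously differentiable, $\bar f_0$ is bounded below, $\bar c_I,\bar g_0,\bar J_I$ are bounded, and $\bar g_0$ and $\bar J_I$ are Lipschitz continuous with constants $L_g,L_J>0$. With constants $\epsilon_g,\epsilon_J>0$ and the $\epsilon_f,\epsilon_c$ of the algorithm, $|\bar f_0-f_0|\le\epsilon_f$, $\|\bar g_0-g_0\|\le\epsilon_g$, $\|\bar c_I-c_I\|\le\epsilon_c$ and $\|\bar J_I-J_I\|\le\epsilon_J$ on $\mathcal X$. * (A2, $W_k$) For all $k$ the linear system of step 3 has a unique solution, both for $(J_k,g_k,v_k)$ and for $(\bar J_k,\bar g_k,\bar v_k)$; there are $\sigma_W,\kappa_W>0$ such that for all $k$ one has $p^TW_kp\ge\sigma_W\|p\|^2$ for all $p\in\mathrm{null}(J_k)\cup\mathrm{null}(\bar J_k)$,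 and $\|W_k\|\le\kappa_W$. * (A3, slacks) $\sup_k\|s_k\|<\infty$. * (A4) There are $k_J\in\mathbb N$ and $\gamma>\epsilon_J$ with $\sigma_{\min}(J_k)\ge\gamma$ for all $k\ge k_J$. * (A5, noise level) There are $\lambda\ge0$ and $\sigma_\Gamma>0$ such that the matrices $\Gamma_k=W_k+\lambda J_k^TJ_k$ and $\bar\Gamma_k=W_k+\lambda\bar J_k^T\bar J_k$ have smallest singular values at least $\sigma_\Gamma$ for all $k$, and for all $k\ge k_J$ $$\|(\bar J_k\bar\Gamma_k^{-1}\bar J_k^T)^{-1}\|\big(\|\bar J_k\|\,\|\Gamma_k^{-1}J_k^T-\bar\Gamma_k^{-1}\bar J_k^T\|+\|\bar\Gamma_k^{-1}\bar J_k^T\|\epsilon_J+\|\Gamma_k^{-1}J_k^T-\bar\Gamma_k^{-1}\bar J_k^T\|\epsilon_J\big)<1.$$ **Notation.** Let $\varepsilon_{g,k}=g_k-\bar g_k$, $\varepsilon_{c,k}=c_k-\bar c_k$, $\varepsilon_{J,k}=J_k-\bar J_k$, $\varepsilon_{d,k}=d_k-\bar d_k$, $\varepsilon_{\tau,k}=\tau_k-\bar\tau_k$,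 $\xi_0(\tau)=\max\{\frac12(\tau L_g+L_J),\frac{\tau\mu}{1-\eta_s}\}$, $$\begin{aligned}E_k^{m,1}={}&-(\bar\tau_k+\varepsilon_{\tau,k})\varepsilon_{g,k}^T(\bar d_k+\varepsilon_{d,k})+\|\bar c_k+\varepsilon_{c,k}\|-\|\bar c_k\|\\&-\big(\|\bar c_k+\bar J_k\bar d_k+\bar J_k\varepsilon_{d,k}+\varepsilon_{c,k}+\varepsilon_{J,k}\bar d_k+\varepsilon_{J,k}\varepsilon_{d,k}\|-\|\bar c_k+\bar J_k\bar d_k+\bar J_k\varepsilon_{d,k}\|\big),\\E_k^{m,2}={}&-\bar\tau_k\bar g_k^T\varepsilon_{d,k}-\varepsilon_{\tau,k}\bar g_k^T\bar d_k-\varepsilon_{\tau,k}\bar g_k^T\varepsilon_{d,k}+\|\bar c_k+\bar J_k\bar d_k\|-\|\bar c_k+\bar J_k\bar d_k+\bar J_k\varepsilon_{d,k}\|,\end{aligned}$$ $E_k^m=E_k^{m,1}+E_k^{m,2}$, and $$\hat\alpha_k=\min\Big\{\frac{(1-\eta_\phi)\Delta\bar m_k(\bar d_k,\bar\tau_k)}{2\xi_0(\tau_k)\|\bar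 d_k+\varepsilon_{d,k}\|^2},\ \alpha_k^{\max}\Big\}.$$ **Theorem.** Suppose that the algorithm does not terminate and that (A1), (A2), (A3) hold. Then there is $k\in\mathbb N$ with $$\Delta\bar m_k(\bar d_k,\bar\tau_k)\le\max\Big\{\frac{2(\eta_\phi E_k^{m,1}-(1-\eta_\phi)E_k^{m,2})}{1-\eta_\phi},\ -2E_k^m,\ \frac{4(4+2\zeta)\varepsilon_k}{\hat\alpha_k\eta_\phi}\Big\}.$$ Suppose in addition that (A4) and (A5) hold, with the same $k_J$. Then there are $k_{\bar\tau}\in\mathbb N$ and $\bar\tau,\xi_d,g_{\sup},J_{\sup}>0$, $\epsilon_d\ge0$ such that (i) $\bar\tau_k=\bar\tau$ for all $k\ge k_{\bar\tau}$; (ii) $\xi_d\|\bar d_k\|^2\le\Delta\bar m_k(\bar d_k,\bar\tau_k)$ for all $k$; (iii) $\|d_k-\bar d_k\|\le\epsilon_d$ for all $k\ge k_J$; (iv) $\|\bar g_k\|\le g_{\sup}$ and $\|\bar J_k\|\le J_{\sup}$ for all $k$. For every choice of such quantities there is $k\ge k_{\bar\tau}$ with $$\Delta\bar m_k(\bar d_k,\bar\tau)\le\max\{\rho_{k,1},\rho_{k,2},\rho_{k,3}\},$$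 where $$\begin{aligned}\rho_{k,1}&=2\Big(\tfrac{\eta_\phi}{1-\eta_\phi}e_1+c_1+\xi_d^{-1/2}\big(\tfrac{\eta_\phi}{1-\eta_\phi}e_2+c_2\big)\Delta\bar m_k(\bar d_k,\bar\tau)^{1/2}\Big),\\\rho_{k,2}&=2\Big(e_1+c_1+\xi_d^{-1/2}(e_2+c_2)\Delta\bar m_k(\bar d_k,\bar\tau)^{1/2}\Big),\\\rho_{k,3}&=\frac{4(4+2\zeta)\varepsilon_k}{\bar\alpha_k\eta_\phi},\qquad\bar\alpha_k=\min\Big\{\frac{(1-\eta_\phi)\xi_d\Delta\bar m_k(\bar d_k,\bar\tau)}{4\xi_0(\tau_k)(\Delta\bar m_k(\bar d_k,\bar\tau)+\xi_d\epsilon_d^2)},\ \alpha_k^{\max}\Big\},\end{aligned}$$ with the iteration-independent constants $e_1=(\tau_0\epsilon_g+\epsilon_J)\epsilon_d+2\epsilon_c$, $e_2=\tau_0\epsilon_g+\epsilon_J$, $c_1=(\tau_0g_{\sup}+J_{\sup})\epsilon_d$ and $c_2=\max\{\tau_0,\bar\tau_0\}\,g_{\sup}$. (If $\Delta\bar m_k=0$,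 both displayed bounds hold trivially.) -/

import Mathlib

/-!
An interior-point method for one barrier subproblem
  `min f̄₀(x) - μ ∑ log s⁽ⁱ⁾  s.t.  c̄_I(x) + s = 0, s > 0`
that only has access to noisy function and derivative values.
-/

namespace NoisyIP

/-- `ℝᵐ` with the Euclidean norm. -/
abbrev Vec (m : ℕ) := EuclideanSpace ℝ (Fin m)

/-- `ℝⁿ⁺q`, as pairs `(x, s)` with the Euclidean norm. -/
abbrev PVec (n q : ℕ) := WithLp 2 (Vec n × Vec q)

/-- Function and derivative values: objective, its gradient, constraint function, its Jacobian.
Matrices are continuous linear maps, so that their norm is the induced 2-norm. -/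
structure Oracle (n q : ℕ) where
  f : Vec n → ℝ
  g : Vec n → Vec n
  c : Vec n → Vec q
  J : Vec n → (Vec n →L[ℝ] Vec q)

/-- The noiseless values that belong to an objective and a constraint function. -/
noncomputable def exactOracle {n q : ℕ} (f : Vec n → ℝ) (c : Vec n → Vec q) : Oracle n q where
  f := f
  g := gradient f
  c := c
  J := fderiv ℝ c

/-- Parameters of the algorithm; `εf` and `εc` are the noise bounds that its line search uses and
`τinit` is the merit parameter value `τ₋₁`. -/
structure Params where
  μ : ℝ
  εf : ℝ
  εc : ℝ
  τinit : ℝ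
  ω : ℝ
  σ : ℝ
  δτ : ℝ
  ηs : ℝ
  ηφ : ℝ
  ζ : ℝ

/-- The admissible ranges of the parameters. -/
structure Params.Admissible (P : Params) : Prop where
  μ_pos : 0 < P.μ
  εf_pos : 0 < P.εf
  εc_pos : 0 < P.εc
  τinit_pos : 0 < P.τinit
  ω_pos : 0 < P.ω
  σ_mem : P.σ ∈ Set.Ioo (0 : ℝ) 1
  δτ_mem : P.δτ ∈ Set.Ioo (0 : ℝ) 1
  ηs_mem : P.ηs ∈ Set.Ioo (0 : ℝ) 1
  ηφ_mem : P.ηφ ∈ Set.Ioo (0 : ℝ) 1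
  ζ_pos : 0 < P.ζ

/-- The diagonal matrix `diag(s)`. -/
noncomputable def diag {q : ℕ} (s : Vec q) : Vec q →L[ℝ] Vec q :=
  Matrix.toEuclideanCLM (n := Fin q) (𝕜 := ℝ) (Matrix.diagonal s.ofLp)

/-- The block diagonal matrix with blocks `H` and `diag(ς)`. -/
noncomputable def blockW {n q : ℕ} (H : Vec n →L[ℝ] Vec n) (ς : Vec q) :
    PVec n q →L[ℝ] PVec n q :=
  (WithLp.prodContinuousLinearEquiv 2 ℝ (Vec n) (Vec q)).symm.toContinuousLinearMap ∘L
    ((H ∘L WithLp.fstL 2 ℝ (Vec n) (Vec q)).prod (diag ς ∘L WithLp.sndL 2 ℝ (Vec n) (Vec q)))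

namespace Oracle

variable {n q : ℕ} (O : Oracle n q)

/-- Barrier objective `f(z) = f₀(x) - μ ∑ log s⁽ⁱ⁾`. -/
noncomputable def obj (μ : ℝ) (x : Vec n) (s : Vec q) : ℝ :=
  O.f x - μ * ∑ i, Real.log (s i)

/-- Constraint function `c(z) = c_I(x) + s`. -/
noncomputable def con (x : Vec n) (s : Vec q) : Vec q := O.c x + s

/-- Scaled gradient `(g₀(x), -μ e)`. -/
noncomputable def grad (μ : ℝ) (x : Vec n) : PVec n q :=
  WithLp.toLp 2 (O.g x, WithLp.toLp 2 (fun _ => -μ))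

/-- Scaled Jacobian `[J_I(x)  S]`. -/
noncomputable def jac (x : Vec n) (s : Vec q) : PVec n q →L[ℝ] Vec q :=
  O.J x ∘L WithLp.fstL 2 ℝ (Vec n) (Vec q) + diag s ∘L WithLp.sndL 2 ℝ (Vec n) (Vec q)

/-- Merit function `φ(z, τ) = τ f(z) + ‖c(z)‖`. -/
noncomputable def merit (μ : ℝ) (x : Vec n) (s : Vec q) (τ : ℝ) : ℝ :=
  τ * O.obj μ x s + ‖O.con x s‖

/-- Model reduction `Δm(d, τ) = -τ gᵀd + ‖c‖ - ‖c + J d‖` at `z = (x, s)`. -/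
noncomputable def modelRed (μ : ℝ) (x : Vec n) (s : Vec q) (d : PVec n q) (τ : ℝ) : ℝ :=
  -τ * inner ℝ (O.grad μ x) d + ‖O.con x s‖ - ‖O.con x s + O.jac x s d‖

end Oracle

/-- `v` solves `min ½‖c + J v‖²` over `v ∈ range(Jᵀ)` with `‖v‖ ≤ ω ‖Jᵀ c‖`. -/
def IsNormalStep {n q : ℕ} (ω : ℝ) (c : Vec q) (J : PVec n q →L[ℝ] Vec q) (v : PVec n q) : Prop :=
  IsMinOn (fun w : PVec n q => (1 / 2 : ℝ) * ‖c + J w‖ ^ 2)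
    {w | w ∈ Set.range J.adjoint ∧ ‖w‖ ≤ ω * ‖J.adjoint c‖} v ∧
  v ∈ Set.range J.adjoint ∧ ‖v‖ ≤ ω * ‖J.adjoint c‖

/-- `(d, y)` solves `W d + Jᵀ y = -g`, `J d = J v`. -/
def IsNewtonStep {n q : ℕ} (W : PVec n q →L[ℝ] PVec n q) (J : PVec n q →L[ℝ] Vec q)
    (g v : PVec n q) (p : PVec n q × Vec q) : Prop :=
  W p.1 + J.adjoint p.2 = -g ∧ J p.1 = J v

/-- The new merit parameter value, from the previous value `τ`, `num = ‖c‖ - ‖c + J v‖` and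
`den = gᵀd + ½ uᵀW u`: the trial value is `∞` if `den ≤ 0`, and `(1 - σ) num / den` otherwise;
the previous value is kept if it is at most the trial value. -/
noncomputable def nextMerit (σ δτ τ num den : ℝ) : ℝ :=
  if den ≤ 0 ∨ τ ≤ (1 - σ) * num / den then τ
  else min ((1 - δτ) * τ) ((1 - σ) * num / den)

/-- The merit parameter update at `(x, s)` with respect to the values of `O`, for the normal step
`v` and the full step `d` (so that `u = d - v`). -/
noncomputable def Oracle.updateMerit {n q : ℕ} (O : Oracle n q) (P : Params)
    (x : Vec n) (s : Vec q) (W : PVec n q →L[ℝ] PVec n q) (v d : PVec n q) (τ : ℝ) : ℝ :=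
  nextMerit P.σ P.δτ τ
    (‖O.con x s‖ - ‖O.con x s + O.jac x s v‖)
    (inner ℝ (O.grad P.μ x) d + (1 / 2) * inner ℝ (d - v) (W (d - v)))

/-- The quantities generated by the algorithm. The multiplier computed in iteration `k` is
`y (k + 1)`, and `W_k = diag(H_k, Σ_k)` with `Σ_k = diag(ς_k)`. -/
structure Trace (n q : ℕ) where
  x : ℕ → Vec n
  s : ℕ → Vec q
  y : ℕ → Vec q
  H : ℕ → (Vec n →L[ℝ] Vec n)
  ς : ℕ → Vec q
  v : ℕ → PVec n q
  d : ℕ → PVec n q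
  τ : ℕ → ℝ
  αmax : ℕ → ℝ
  α : ℕ → ℝ

namespace Trace

variable {n q : ℕ} (T : Trace n q)

noncomputable def W (k : ℕ) : PVec n q →L[ℝ] PVec n q := blockW (T.H k) (T.ς k)

/-- The slack vector `s_k + a S_k d_kˢ`. -/
noncomputable def slackAt (k : ℕ) (a : ℝ) : Vec q := T.s k + a • diag (T.s k) (T.d k).snd

/-- The point `x_k + a d_kˣ`. -/
noncomputable def xAt (k : ℕ) (a : ℝ) : Vec n := T.x k + a • (T.d k).fst

/-- `ε_k = τ_k ε_f + ε_c`. -/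
noncomputable def ε (P : Params) (k : ℕ) : ℝ := T.τ k * P.εf + P.εc

/-- The relaxed Armijo condition for the step size `a` in iteration `k`. -/
def Armijo (O : Oracle n q) (P : Params) (k : ℕ) (a : ℝ) : Prop :=
  O.merit P.μ (T.xAt k a) (T.slackAt k a) (T.τ k) ≤
    O.merit P.μ (T.x k) (T.s k) (T.τ k)
      - P.ηφ * a * O.modelRed P.μ (T.x k) (T.s k) (T.d k) (T.τ k)
      + (2 + P.ζ) * T.ε P k

end Trace

/-- `T` is a run of the algorithm with the noisy values `O` that does not terminate. -/
structure IsInfiniteRun {n q : ℕ} (O : Oracle n q) (P : Params) (T : Trace n q) : Prop where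
  slack_init : ∀ i, 0 < T.s 0 i
  con_init : ∀ i, 0 ≤ O.con (T.x 0) (T.s 0) i
  no_infeasible_stop : ∀ k,
    ¬ ((O.jac (T.x k) (T.s k)).adjoint (O.con (T.x k) (T.s k)) = 0 ∧ ¬ ∀ i, O.c (T.x k) i ≤ 0)
  normal : ∀ k, IsNormalStep P.ω (O.con (T.x k) (T.s k)) (O.jac (T.x k) (T.s k)) (T.v k)
  H_symm : ∀ k, (T.H k : Vec n →ₗ[ℝ] Vec n).IsSymmetric
  ς_pos : ∀ k i, 0 < T.ς k i
  newton : ∀ k, IsNewtonStep (T.W k) (O.jac (T.x k) (T.s k)) (O.grad P.μ (T.x k)) (T.v k)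
    (T.d k, T.y (k + 1))
  no_stationary_stop : ∀ k,
    ¬ ((O.jac (T.x k) (T.s k)).adjoint (O.con (T.x k) (T.s k)) = 0 ∧
      O.grad P.μ (T.x k) + (O.jac (T.x k) (T.s k)).adjoint (T.y (k + 1)) = 0)
  merit_zero : T.τ 0 = O.updateMerit P (T.x 0) (T.s 0) (T.W 0) (T.v 0) (T.d 0) P.τinit
  merit_succ : ∀ k, T.τ (k + 1) =
    O.updateMerit P (T.x (k + 1)) (T.s (k + 1)) (T.W (k + 1)) (T.v (k + 1)) (T.d (k + 1)) (T.τ k)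
  boundary : ∀ k,
    IsGreatest {a : ℝ | 0 < a ∧ a ≤ 1 ∧ ∀ i, (1 - P.ηs) * T.s k i ≤ T.slackAt k a i} (T.αmax k)
  line_search : ∀ k, ∃ j : ℕ,
    IsLeast {j : ℕ | T.Armijo O P k ((1 / 2 : ℝ) ^ j * T.αmax k)} j ∧
      T.α k = (1 / 2 : ℝ) ^ j * T.αmax k
  x_succ : ∀ k, T.x (k + 1) = T.xAt k (T.α k)
  slack_reset : ∀ k i, T.s (k + 1) i = max (T.slackAt k (T.α k) i) (-(O.c (T.x (k + 1)) i))

/-- The noiseless counterparts `v̄_k`, `d̄_k`, `ȳ_k`, `τ̄_k` along given iterates. -/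
structure Shadow (n q : ℕ) where
  v : ℕ → PVec n q
  d : ℕ → PVec n q
  y : ℕ → Vec q
  τ : ℕ → ℝ

/-- `B` consists of the values that would have been computed along the iterates of `T`, with the
same matrices `W_k`, from the noiseless values `Ō`. -/
structure IsShadow {n q : ℕ} (Obar : Oracle n q) (P : Params) (T : Trace n q)
    (B : Shadow n q) : Prop where
  normal : ∀ k, IsNormalStep P.ω (Obar.con (T.x k) (T.s k)) (Obar.jac (T.x k) (T.s k)) (B.v k)
  newton : ∀ k, IsNewtonStep (T.W k) (Obar.jac (T.x k) (T.s k)) (Obar.grad P.μ (T.x k)) (B.v k)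
    (B.d k, B.y (k + 1))
  merit_zero : B.τ 0 = Obar.updateMerit P (T.x 0) (T.s 0) (T.W 0) (B.v 0) (B.d 0) P.τinit
  merit_succ : ∀ k, B.τ (k + 1) =
    Obar.updateMerit P (T.x (k + 1)) (T.s (k + 1)) (T.W (k + 1)) (B.v (k + 1)) (B.d (k + 1)) (B.τ k)

/-- Regular problem data and bounded noise on an open convex set `X` that contains the iterates
and the first trial point of every line search (hence all points at which the algorithm evaluates
functions). -/
structure RegularData {n q : ℕ} (fbar : Vec n → ℝ) (cbar : Vec n → Vec q) (O : Oracle n q)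
    (P : Params) (εg εJ : ℝ) (X : Set (Vec n)) (Lg LJ : ℝ) (T : Trace n q) : Prop where
  isOpen : IsOpen X
  convex : Convex ℝ X
  iterate_mem : ∀ k, T.x k ∈ X
  trial_mem : ∀ k, T.xAt k (T.αmax k) ∈ X
  f_diff : ContDiffOn ℝ 1 fbar X
  c_diff : ContDiffOn ℝ 1 cbar X
  f_bdd : ∃ finf : ℝ, ∀ x ∈ X, finf ≤ fbar x
  c_bdd : ∃ csup : ℝ, ∀ x ∈ X, ‖cbar x‖ ≤ csup
  g_bdd : ∃ gsup : ℝ, ∀ x ∈ X, ‖gradient fbar x‖ ≤ gsup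
  J_bdd : ∃ Jsup : ℝ, ∀ x ∈ X, ‖fderiv ℝ cbar x‖ ≤ Jsup
  Lg_pos : 0 < Lg
  LJ_pos : 0 < LJ
  g_lip : ∀ x ∈ X, ∀ x' ∈ X, ‖gradient fbar x - gradient fbar x'‖ ≤ Lg * ‖x - x'‖
  J_lip : ∀ x ∈ X, ∀ x' ∈ X, ‖fderiv ℝ cbar x - fderiv ℝ cbar x'‖ ≤ LJ * ‖x - x'‖
  εg_pos : 0 < εg
  εJ_pos : 0 < εJ
  f_noise : ∀ x ∈ X, |fbar x - O.f x| ≤ P.εf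
  g_noise : ∀ x ∈ X, ‖gradient fbar x - O.g x‖ ≤ εg
  c_noise : ∀ x ∈ X, ‖cbar x - O.c x‖ ≤ P.εc
  J_noise : ∀ x ∈ X, ‖fderiv ℝ cbar x - O.J x‖ ≤ εJ

/-- The matrices `W_k` are well behaved: unique solvability, uniform positive definiteness on the
null spaces of the noisy and noiseless Jacobians, and boundedness. -/
structure WellBehavedW {n q : ℕ} (Obar O : Oracle n q) (P : Params) (T : Trace n q)
    (B : Shadow n q) : Prop where
  unique_noisy : ∀ k, ∃! p : PVec n q × Vec q,
    IsNewtonStep (T.W k) (O.jac (T.x k) (T.s k)) (O.grad P.μ (T.x k)) (T.v k) p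
  unique_exact : ∀ k, ∃! p : PVec n q × Vec q,
    IsNewtonStep (T.W k) (Obar.jac (T.x k) (T.s k)) (Obar.grad P.μ (T.x k)) (B.v k) p
  pos_def : ∃ σW : ℝ, 0 < σW ∧ ∀ k, ∀ p : PVec n q,
    (O.jac (T.x k) (T.s k) p = 0 ∨ Obar.jac (T.x k) (T.s k) p = 0) →
      σW * ‖p‖ ^ 2 ≤ inner ℝ p (T.W k p)
  bdd : ∃ κW : ℝ, 0 < κW ∧ ∀ k, ‖T.W k‖ ≤ κW

/-- The slack iterates are bounded. -/
def BoundedSlacks {n q : ℕ} (T : Trace n q) : Prop :=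
  ∃ ssup : ℝ, 0 < ssup ∧ ∀ k, ‖T.s k‖ ≤ ssup

/-- `ξ₀(τ) = max{½(τ L_g + L_J), τ μ / (1 - η_s)}`. -/
noncomputable def ξ₀ (P : Params) (Lg LJ τ : ℝ) : ℝ :=
  max ((1 / 2) * (τ * Lg + LJ)) (τ * P.μ / (1 - P.ηs))

section Errors

variable {n q : ℕ} (Obar O : Oracle n q) (P : Params) (T : Trace n q) (B : Shadow n q) (k : ℕ)

/-- `Δm̄_k(d̄_k, t)`. -/
noncomputable def statMeas (t : ℝ) : ℝ :=
  Obar.modelRed P.μ (T.x k) (T.s k) (B.d k) t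

noncomputable def errG : PVec n q := O.grad P.μ (T.x k) - Obar.grad P.μ (T.x k)

noncomputable def errC : Vec q := O.con (T.x k) (T.s k) - Obar.con (T.x k) (T.s k)

noncomputable def errJ : PVec n q →L[ℝ] Vec q := O.jac (T.x k) (T.s k) - Obar.jac (T.x k) (T.s k)

noncomputable def errD : PVec n q := T.d k - B.d k

noncomputable def errτ : ℝ := T.τ k - B.τ k

/-- `E_k^{m,1}`. -/
noncomputable def E₁ : ℝ :=
  let cb := Obar.con (T.x k) (T.s k)
  let Jb := Obar.jac (T.x k) (T.s k)
  let eg := errG Obar O P T k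
  let ec := errC Obar O T k
  let eJ := errJ Obar O T k
  let ed := errD T B k;
  -(B.τ k + errτ T B k) * inner ℝ eg (B.d k + ed) + ‖cb + ec‖ - ‖cb‖
    - (‖cb + Jb (B.d k) + Jb ed + ec + eJ (B.d k) + eJ ed‖ - ‖cb + Jb (B.d k) + Jb ed‖)

/-- `E_k^{m,2}`. -/
noncomputable def E₂ : ℝ :=
  let cb := Obar.con (T.x k) (T.s k)
  let Jb := Obar.jac (T.x k) (T.s k)
  let gb := Obar.grad P.μ (T.x k)
  let ed := errD T B k;
  -(B.τ k) * inner ℝ gb ed - errτ T B k * inner ℝ gb (B.d k) - errτ T B k * inner ℝ gb ed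
    + ‖cb + Jb (B.d k)‖ - ‖cb + Jb (B.d k) + Jb ed‖

/-- `E_k^m = E_k^{m,1} + E_k^{m,2}`. -/
noncomputable def Em : ℝ := E₁ Obar O P T B k + E₂ Obar P T B k

/-- The step size threshold `α̂_k`. (Here `d̄_k + ε_{d,k} = d_k` is nonzero in every iteration of
a run that does not terminate.) -/
noncomputable def αhat (Lg LJ : ℝ) : ℝ :=
  min ((1 - P.ηφ) * statMeas Obar P T B k (B.τ k)
      / (2 * ξ₀ P Lg LJ (T.τ k) * ‖B.d k + errD T B k‖ ^ 2)) (T.αmax k)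

end Errors

/-- The smallest singular value: the one of index `min(dim E, dim F)` in decreasing order
(counted from 1). -/
noncomputable def sigmaMin {E F : Type*} [NormedAddCommGroup E] [InnerProductSpace ℝ E]
    [FiniteDimensional ℝ E] [NormedAddCommGroup F] [InnerProductSpace ℝ F]
    [FiniteDimensional ℝ F] (A : E →L[ℝ] F) : ℝ :=
  (A : E →ₗ[ℝ] F).singularValues (min (Module.finrank ℝ E) (Module.finrank ℝ F) - 1)

/-- From iteration `kJ` on, the singular values of the noisy Jacobians are at least `γ > ε_J`. -/
def SingularValuesAbove {n q : ℕ} (O : Oracle n q) (εJ : ℝ) (T : Trace n q) (kJ : ℕ) (γ : ℝ) :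
    Prop :=
  εJ < γ ∧ ∀ k, kJ ≤ k → γ ≤ sigmaMin (O.jac (T.x k) (T.s k))

/-- `Γ = W + λ JᵀJ`. -/
noncomputable def gammaMat {n q : ℕ} (W : PVec n q →L[ℝ] PVec n q) (J : PVec n q →L[ℝ] Vec q)
    (lam : ℝ) : PVec n q →L[ℝ] PVec n q :=
  W + lam • (J.adjoint ∘L J)

/-- The noise-level assumption: with `Γ_k = W_k + λ J_kᵀJ_k` and `Γ̄_k = W_k + λ J̄_kᵀJ̄_k`, whose
smallest singular values are at least some `σ_Γ > 0` for all `k`, one has for all `k ≥ kJ`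
`‖(J̄Γ̄⁻¹J̄ᵀ)⁻¹‖ (‖J̄‖ ‖Γ⁻¹Jᵀ - Γ̄⁻¹J̄ᵀ‖ + ‖Γ̄⁻¹J̄ᵀ‖ ε_J + ‖Γ⁻¹Jᵀ - Γ̄⁻¹J̄ᵀ‖ ε_J) < 1`. -/
def NoiseLevel {n q : ℕ} (Obar O : Oracle n q) (εJ : ℝ) (T : Trace n q) (kJ : ℕ) : Prop :=
  ∃ lam σΓ : ℝ, 0 ≤ lam ∧ 0 < σΓ ∧
    (∀ k, σΓ ≤ min (sigmaMin (gammaMat (T.W k) (O.jac (T.x k) (T.s k)) lam))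
      (sigmaMin (gammaMat (T.W k) (Obar.jac (T.x k) (T.s k)) lam))) ∧
    ∀ k, kJ ≤ k →
      let J := O.jac (T.x k) (T.s k)
      let Jb := Obar.jac (T.x k) (T.s k)
      let A := (gammaMat (T.W k) J lam).inverse ∘L J.adjoint
      let Ab := (gammaMat (T.W k) Jb lam).inverse ∘L Jb.adjoint
      ‖(Jb ∘L Ab).inverse‖ * (‖Jb‖ * ‖A - Ab‖ + ‖Ab‖ * εJ + ‖A - Ab‖ * εJ) < 1

/-- Iteration-independent quantities. -/
structure Consts where
  kτ : ℕ
  τlim : ℝ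
  ξd : ℝ
  εd : ℝ
  gsup : ℝ
  Jsup : ℝ

/-- The defining properties of the iteration-independent quantities: `τ̄_k = τ̄ > 0` for all
`k ≥ k_τ̄`; `ξ_d ‖d̄_k‖² ≤ Δm̄_k(d̄_k, τ̄_k)` for all `k`; `‖d_k - d̄_k‖ ≤ ε_d` for all `k ≥ k_J`;
`‖ḡ_k‖ ≤ g_sup` and `‖J̄_k‖ ≤ J_sup` for all `k`. -/
structure Consts.Valid {n q : ℕ} (C : Consts) (Obar : Oracle n q) (P : Params) (T : Trace n q)
    (B : Shadow n q) (kJ : ℕ) : Prop where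
  τlim_pos : 0 < C.τlim
  τ_eventually : ∀ k, C.kτ ≤ k → B.τ k = C.τlim
  ξd_pos : 0 < C.ξd
  ξd_le : ∀ k, C.ξd * ‖B.d k‖ ^ 2 ≤ statMeas Obar P T B k (B.τ k)
  εd_nonneg : 0 ≤ C.εd
  εd_bound : ∀ k, kJ ≤ k → ‖T.d k - B.d k‖ ≤ C.εd
  gsup_pos : 0 < C.gsup
  g_bound : ∀ k, ‖Obar.grad (q := q) P.μ (T.x k)‖ ≤ C.gsup
  Jsup_pos : 0 < C.Jsup
  J_bound : ∀ k, ‖Obar.jac (T.x k) (T.s k)‖ ≤ C.Jsup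

section Rho

variable {n q : ℕ} (Obar : Oracle n q) (P : Params) (εg εJ Lg LJ : ℝ) (T : Trace n q)
  (B : Shadow n q) (C : Consts) (k : ℕ)

noncomputable def e₁ : ℝ := (T.τ 0 * εg + εJ) * C.εd + 2 * P.εc

noncomputable def e₂ : ℝ := T.τ 0 * εg + εJ

noncomputable def c₁ : ℝ := (T.τ 0 * C.gsup + C.Jsup) * C.εd

/-- `max{τ₀, τ̄₀}` bounds `|τ_k - τ̄_k|` for all `k`. -/
noncomputable def c₂ : ℝ := max (T.τ 0) (B.τ 0) * C.gsup

/-- The step size threshold `ᾱ_k`. -/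
noncomputable def αbar : ℝ :=
  min ((1 - P.ηφ) * C.ξd * statMeas Obar P T B k C.τlim
      / (4 * ξ₀ P Lg LJ (T.τ k) * (statMeas Obar P T B k C.τlim + C.ξd * C.εd ^ 2))) (T.αmax k)

noncomputable def ρ₁ : ℝ :=
  2 * (P.ηφ / (1 - P.ηφ) * e₁ P εg εJ T C + c₁ T C
    + 1 / √C.ξd * (P.ηφ / (1 - P.ηφ) * e₂ εg εJ T + c₂ T B C)
      * √(statMeas Obar P T B k C.τlim))

noncomputable def ρ₂ : ℝ :=
  2 * (e₁ P εg εJ T C + c₁ T C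
    + 1 / √C.ξd * (e₂ εg εJ T + c₂ T B C) * √(statMeas Obar P T B k C.τlim))

noncomputable def ρ₃ : ℝ :=
  4 * (4 + 2 * P.ζ) * T.ε P k / (αbar Obar P Lg LJ T B C k * P.ηφ)

end Rho

end NoisyIP

/-! The proof is by contradiction. Suppose the first bound fails for every k ≥ N. The three entries
of the maximum then play separate roles. The first entry makes the relaxed Armijo condition hold for
all step sizes up to `αhat`: Taylor expansion bounds the exact merit function
(`exact_merit_descent`), function noise at the two end points costs 2ε_k, and the model errors are
absorbed (`armijo_of_le_αhat`). Backtracking therefore accepts at least half of `αhat`. The second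
entry keeps the noisy model reduction above half of the exact one. The third makes the guaranteed
decrease at least (4+2ζ)ε_k, twice the relaxation term. So every iteration lowers the noisy merit
function by at least ε_c (`merit_decrease`). After the barrier objective is shifted to be
nonnegative, this survives decreases of τ_k and contradicts boundedness below
(`exists_statMeas_le`).

Since N is arbitrary, the bound also holds at some k past both k_τ̄ and k_J. There E₁ and E₂ are
estimated by ‖d̄_k‖ and constants, and ‖d̄_k‖ by the square root of the model reduction, which gives
the ρ's (`statMeas_le_max_ρ`). The constants exist because the noiseless Jacobians keep the rank
bound γ - ε_J, so that trial merit parameters stay away from zero and τ̄_k settles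
(`IsShadow.τ_eventually_const`). Facts about merit parameters and steps are proved for `IsShadow`
with an arbitrary oracle and thus serve both the noisy run and its noiseless counterpart. -/

namespace NoisyIP

/-! ### Singular values and Taylor estimates -/

section General

variable {E F : Type*} [NormedAddCommGroup E] [InnerProductSpace ℝ E]
  [NormedAddCommGroup F] [InnerProductSpace ℝ F]

open Module in
/-- If `A` has full row rank and its singular values are at least `s > 0`, then so is the lower
bound of its adjoint. -/
theorem mul_norm_le_norm_adjoint_of_le_sigmaMin [FiniteDimensional ℝ E] [FiniteDimensional ℝ F]
    {A : E →L[ℝ] F} {s : ℝ} (hs : 0 < s) (hA : s ≤ sigmaMin A) (hEF : finrank ℝ F ≤ finrank ℝ E)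
    (y : F) : s * ‖y‖ ≤ ‖A.adjoint y‖ := by
  -- For trivial `F` the index `finrank - 1` truncates to 0, so this case is separate.
  rcases Nat.eq_zero_or_pos (finrank ℝ F) with h0 | hpos
  · have := finrank_zero_iff.1 h0
    simp [Subsingleton.elim y 0]
  set T : E →ₗ[ℝ] F := (A : E →ₗ[ℝ] F) with hT
  have hadj : ∀ z, T.adjoint z = A.adjoint z := fun z => rfl
  have hA' : s ≤ T.singularValues (finrank ℝ F - 1) := by
    simpa [sigmaMin, min_eq_right hEF] using hA
  have hrank : finrank ℝ F - 1 < finrank ℝ T.range :=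
    T.singularValues_pos_iff_lt_finrank_range.1 (hs.trans_le hA')
  have htop : T.range = ⊤ := by
    apply Submodule.eq_top_of_finrank_eq
    have := Submodule.finrank_le T.range
    omega
  have htop' : (T ∘ₗ T.adjoint).range = ⊤ := by
    rw [LinearMap.range_self_comp_adjoint, htop]
  -- The preimage of `y` is taken in the range of the adjoint, so it has no component along
  -- eigenvectors with singular value zero; on the others the singular value is at least `s`.
  obtain ⟨w, hw⟩ : y ∈ (T ∘ₗ T.adjoint).range := by rw [htop']; trivial
  set x := T.adjoint w with hx
  have hy : T x = y := hw
  set b := T.isSymmetric_adjoint_comp_self.eigenvectorBasis rfl with hb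
  have hcoord : ∀ i : Fin (finrank ℝ E),
      s ^ 2 * (inner ℝ (b i) x) ^ 2 ≤ T.singularValues i ^ 2 * (inner ℝ (b i) x) ^ 2 := by
    intro i
    rcases (T.singularValues_nonneg i).eq_or_lt with h | h
    · have h1 : (T.adjoint ∘ₗ T) (b i) = 0 := by
        rw [hb, T.isSymmetric_adjoint_comp_self.apply_eigenvectorBasis rfl i,
          ← T.sq_singularValues_fin rfl i, ← h]
        simp
      have h2 : T (b i) = 0 := by
        rw [← inner_self_eq_zero (𝕜 := ℝ), ← LinearMap.adjoint_inner_right]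
        have h1' : T.adjoint (T (b i)) = 0 := h1
        rw [h1', inner_zero_right]
      have h3 : inner ℝ (b i) x = 0 := by
        rw [hx, LinearMap.adjoint_inner_right, h2, inner_zero_left]
      simp [h3]
    · have hi : (i : ℕ) ≤ finrank ℝ F - 1 := by
        have := T.singularValues_pos_iff_lt_finrank_range.1 h
        have := Submodule.finrank_le T.range
        omega
      have := hA'.trans (T.singularValues_antitone hi)
      gcongr
  have hnx : s ^ 2 * ‖x‖ ^ 2 ≤ ‖y‖ ^ 2 := by
    have e1 : ‖y‖ ^ 2 = ∑ i : Fin (finrank ℝ E), T.singularValues i ^ 2 * (inner ℝ (b i) x) ^ 2 := by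
      rw [← hy, ← real_inner_self_eq_norm_sq, ← LinearMap.adjoint_inner_right,
        ← b.sum_inner_mul_inner x]
      refine Finset.sum_congr rfl fun i _ => ?_
      have : inner ℝ (b i) (T.adjoint (T x)) = T.singularValues i ^ 2 * inner ℝ (b i) x := by
        rw [← LinearMap.comp_apply, ← T.isSymmetric_adjoint_comp_self (b i) x, hb,
          T.isSymmetric_adjoint_comp_self.apply_eigenvectorBasis rfl i,
          ← T.sq_singularValues_fin rfl i]
        simp [inner_smul_left]
      rw [this, real_inner_comm]
      ring
    have e2 : ‖x‖ ^ 2 = ∑ i, (inner ℝ (b i) x) ^ 2 := by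
      rw [← b.sum_sq_norm_inner_right x]
      simp
    rw [e1, e2, Finset.mul_sum]
    exact Finset.sum_le_sum fun i _ => hcoord i
  have hsx : s * ‖x‖ ≤ ‖y‖ := by
    rw [← mul_pow] at hnx
    exact le_of_sq_le_sq hnx (norm_nonneg _)
  -- Duality: the lower bound for `T` at `x` passes to the adjoint at `y = T x`.
  have hyy : ‖y‖ ^ 2 ≤ ‖A.adjoint y‖ * ‖x‖ := by
    rw [← real_inner_self_eq_norm_sq]
    nth_rewrite 2 [← hy]
    rw [← LinearMap.adjoint_inner_left, hadj]
    exact real_inner_le_norm _ _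
  rcases (norm_nonneg y).eq_or_lt with h | h
  · rw [← h, mul_zero]; positivity
  · have h1 : s * ‖y‖ * ‖y‖ ≤ ‖A.adjoint y‖ * ‖y‖ :=
      calc s * ‖y‖ * ‖y‖ = s * ‖y‖ ^ 2 := by ring
        _ ≤ s * (‖A.adjoint y‖ * ‖x‖) := by gcongr
        _ = ‖A.adjoint y‖ * (s * ‖x‖) := by ring
        _ ≤ _ := by gcongr
    exact le_of_mul_le_mul_right h1 h

/-- First-order Taylor estimate on a segment along which the derivative is Lipschitz. -/
theorem norm_taylor_le_of_lipschitz {f : E → F} {X : Set E} (hX : Convex ℝ X)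
    (hXo : IsOpen X) (hf : ContDiffOn ℝ 1 f X) {L : ℝ}
    (hL : ∀ x ∈ X, ∀ x' ∈ X, ‖fderiv ℝ f x - fderiv ℝ f x'‖ ≤ L * ‖x - x'‖)
    {x h : E} (hx : x ∈ X) (hxh : x + h ∈ X) :
    ‖f (x + h) - f x - fderiv ℝ f x h‖ ≤ L / 2 * ‖h‖ ^ 2 := by
  have hmem : ∀ t ∈ Set.Icc (0 : ℝ) 1, x + t • h ∈ X := fun t ht =>
    hX.add_smul_mem hx hxh ht
  have hd : ∀ t ∈ Set.Icc (0 : ℝ) 1,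
      HasDerivAt (fun t : ℝ => f (x + t • h) - f x - t • fderiv ℝ f x h)
        (fderiv ℝ f (x + t • h) h - fderiv ℝ f x h) t := by
    intro t ht
    have h1 : HasFDerivAt f (fderiv ℝ f (x + t • h)) (x + t • h) :=
      ((hf.differentiableOn (by norm_num)).differentiableAt
        (hXo.mem_nhds (hmem t ht))).hasFDerivAt
    have h2 : HasDerivAt (fun t : ℝ => x + t • h) h t := by
      simpa using ((hasDerivAt_id t).smul_const h).const_add x
    have h3 := h1.comp_hasDerivAt t h2
    have h4 : HasDerivAt (fun t : ℝ => t • fderiv ℝ f x h) (fderiv ℝ f x h) t := by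
      simpa using (hasDerivAt_id t).smul_const (fderiv ℝ f x h)
    exact (h3.sub_const (f x)).sub h4
  -- The remainder along the segment starts at 0 and its derivative is dominated by that of `L / 2 *
  -- ‖h‖ ^ 2 * t ^ 2`.
  have key := image_norm_le_of_norm_deriv_right_le_deriv_boundary
    (a := (0 : ℝ)) (b := 1) (B := fun t => L / 2 * ‖h‖ ^ 2 * t ^ 2)
    (B' := fun t => L * ‖h‖ ^ 2 * t)
    (fun t ht => (hd t ht).continuousAt.continuousWithinAt)
    (fun t ht => (hd t ⟨ht.1, ht.2.le⟩).hasDerivWithinAt)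
    (by simp)
    (fun t => by
      have h1 := (hasDerivAt_pow 2 t).const_mul (L / 2 * ‖h‖ ^ 2)
      have h2 : L / 2 * ‖h‖ ^ 2 * ((2 : ℕ) * t ^ (2 - 1)) = L * ‖h‖ ^ 2 * t := by
        push_cast; ring
      rwa [h2] at h1)
    (fun t ht => by
      rw [← sub_apply]
      calc _ ≤ ‖fderiv ℝ f (x + t • h) - fderiv ℝ f x‖ * ‖h‖ :=
            ContinuousLinearMap.le_opNorm _ _
        _ ≤ (L * ‖x + t • h - x‖) * ‖h‖ := by
            gcongr
            exact hL _ (hmem t ⟨ht.1, ht.2.le⟩) _ hx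
        _ = _ := by
            rw [add_sub_cancel_left, norm_smul, Real.norm_of_nonneg ht.1]; ring)
  simpa using key (Set.right_mem_Icc.2 zero_le_one)

end General

/-- `log (1 + t) ≥ t - t² / (1 - η)` for `t ≥ -η`. -/
theorem sub_sq_div_le_log_one_add {η t : ℝ} (hη : η < 1) (ht : -η ≤ t) :
    t - t ^ 2 / (1 - η) ≤ Real.log (1 + t) := by
  have h0 : 0 < 1 + t := by linarith
  have h1 := Real.one_sub_inv_le_log_of_pos h0
  have h2 : 1 - (1 + t)⁻¹ = t - t ^ 2 / (1 + t) := by field_simp; ring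
  have h3 : t ^ 2 / (1 + t) ≤ t ^ 2 / (1 - η) :=
    div_le_div_of_nonneg_left (sq_nonneg t) (by linarith) (by linarith)
  linarith

/-! ### The merit parameter update -/

section NextMerit

variable {σ δτ τ num den : ℝ}

theorem nextMerit_le (hδ : 0 < δτ) (hτ : 0 < τ) : nextMerit σ δτ τ num den ≤ τ := by
  unfold nextMerit
  split_ifs
  · rfl
  · exact (min_le_left _ _).trans (by nlinarith)

theorem nextMerit_pos (hσ : σ < 1) (hδ : δτ < 1) (hτ : 0 < τ) (h : 0 < den → 0 < num) :
    0 < nextMerit σ δτ τ num den := by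
  unfold nextMerit
  split_ifs with h1
  · exact hτ
  · push Not at h1
    have := h h1.1
    have h2 : 0 < 1 - σ := by linarith
    have h3 : 0 < 1 - δτ := by linarith
    have := h1.1
    exact lt_min (by positivity) (by positivity)

/-- This inequality is the purpose of the update: it yields the lower bound on the model reduction
in `IsShadow.le_modelRed`. -/
theorem nextMerit_mul_le (hσ : σ < 1) (hτ : 0 < τ) (hnum : 0 ≤ num) :
    nextMerit σ δτ τ num den * den ≤ (1 - σ) * num := by
  have h0 : 0 ≤ (1 - σ) * num := mul_nonneg (by linarith) hnum
  unfold nextMerit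
  split_ifs with h1
  · rcases le_or_gt den 0 with hd | hd
    · nlinarith
    · have := h1.resolve_left (not_le.2 hd)
      exact (le_div_iff₀ hd).1 this
  · push Not at h1
    exact (le_div_iff₀ h1.1).1 (min_le_right _ _)

theorem nextMerit_eq_or_le : nextMerit σ δτ τ num den = τ ∨
    nextMerit σ δτ τ num den ≤ (1 - δτ) * τ := by
  unfold nextMerit
  split_ifs with h1
  · exact Or.inl rfl
  · exact Or.inr (min_le_left _ _)

/-- In the decreasing branch the old value exceeds the trial value, hence `t`, so both candidates of
the minimum are at least `(1 - δτ) * t`. Iterated, a uniform bound on trial values keeps the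
parameter away from zero. -/
theorem le_nextMerit {t : ℝ} (hδ : δτ ∈ Set.Ioo (0 : ℝ) 1) (ht : 0 < t)
    (h : 0 < den → t ≤ (1 - σ) * num / den) :
    min τ ((1 - δτ) * t) ≤ nextMerit σ δτ τ num den := by
  unfold nextMerit
  split_ifs with h1
  · exact min_le_left _ _
  · push Not at h1
    have h2 := h h1.1
    refine (min_le_right _ _).trans (le_min ?_ ?_)
    · have : 0 ≤ 1 - δτ := by linarith [hδ.2]
      gcongr
      exact h2.trans h1.2.le
    · nlinarith [hδ.1]

/-- A positive sequence that stays bounded away from zero and of which every change is a decrease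
by at least a fixed factor is eventually constant. -/
theorem eventually_const_of_eq_or_le_mul {u : ℕ → ℝ} {δ t : ℝ} {N : ℕ} (hδ : 0 < δ) (hδ' : δ < 1)
    (ht : 0 < t) (hu : ∀ k, N ≤ k → t ≤ u k)
    (h : ∀ k, u (k + 1) = u k ∨ u (k + 1) ≤ (1 - δ) * u k) :
    ∃ K, ∀ k, K ≤ k → u k = u K := by
  by_contra! hne
  have hstep : ∀ K, N ≤ K → ∀ k, K ≤ k → u k = u K ∨ u k ≤ (1 - δ) * u K := by
    intro K hNK k hk
    induction k, hk using Nat.le_induction with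
    | base => exact Or.inl rfl
    | succ k hk ih =>
      have h0 : t ≤ u k := hu k (hNK.trans hk)
      rcases h k with h1 | h1
      · rwa [h1]
      · right
        rcases ih with h2 | h2
        · rwa [h2] at h1
        · have : 0 < u k := ht.trans_le h0
          nlinarith
  -- Each failure of constancy costs another factor `1 - δ`, so a sequence that never settles would
  -- fall below `t`.
  have hiter : ∀ j : ℕ, ∃ K, N ≤ K ∧ u K ≤ (1 - δ) ^ j * u N := by
    intro j
    induction j with
    | zero => exact ⟨N, le_rfl, by simp⟩
    | succ j ih =>
      obtain ⟨K, hNK, hK⟩ := ih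
      obtain ⟨k, hk, hkne⟩ := hne K
      refine ⟨k, hNK.trans hk, ?_⟩
      have h1 := (hstep K hNK k hk).resolve_left hkne
      calc u k ≤ (1 - δ) * u K := h1
        _ ≤ (1 - δ) * ((1 - δ) ^ j * u N) := by
            have : 0 ≤ 1 - δ := by linarith
            gcongr
        _ = _ := by ring
  have huN : 0 < u N := ht.trans_le (hu N le_rfl)
  obtain ⟨j, hj⟩ := exists_pow_lt_of_lt_one (div_pos ht huN) (by linarith : 1 - δ < 1)
  obtain ⟨K, hNK, hK⟩ := hiter j
  rw [lt_div_iff₀ huN] at hj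
  linarith [hu K hNK]

end NextMerit

/-! ### Normal steps and Newton steps -/

section Steps

variable {n q : ℕ} {ω : ℝ} {c : Vec q} {J : PVec n q →L[ℝ] Vec q} {v : PVec n q}

/-- The normal step achieves at least the decrease of a short steepest descent step. -/
theorem IsNormalStep.decrease (hv : IsNormalStep ω c J v) {t : ℝ} (ht : 0 ≤ t) (htω : t ≤ ω)
    (htJ : t * ‖J‖ ^ 2 ≤ 1) :
    t * ‖J.adjoint c‖ ^ 2 ≤ ‖c‖ ^ 2 - ‖c + J v‖ ^ 2 := by
  set a := J.adjoint c with ha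
  -- The competitor -t Jᵀc is feasible because `t ≤ ω`.
  have hmem : -t • a ∈ {w | w ∈ Set.range J.adjoint ∧ ‖w‖ ≤ ω * ‖J.adjoint c‖} := by
    refine ⟨⟨-t • c, by simp [ha]⟩, ?_⟩
    rw [norm_smul, norm_neg, Real.norm_of_nonneg ht]
    gcongr
  have h1 : (1 / 2 : ℝ) * ‖c + J v‖ ^ 2 ≤ (1 / 2 : ℝ) * ‖c + J (-t • a)‖ ^ 2 := hv.1 hmem
  have h2 : ‖c + J (-t • a)‖ ^ 2 = ‖c‖ ^ 2 - 2 * t * ‖a‖ ^ 2 + t ^ 2 * ‖J a‖ ^ 2 := by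
    rw [map_smul, norm_add_sq_real, inner_smul_right, ← ContinuousLinearMap.adjoint_inner_left,
      ← ha, real_inner_self_eq_norm_sq, norm_smul, mul_pow, norm_neg, Real.norm_eq_abs, sq_abs]
    ring
  have h3 : ‖J a‖ ^ 2 ≤ ‖J‖ ^ 2 * ‖a‖ ^ 2 := by
    rw [← mul_pow]
    exact pow_le_pow_left₀ (norm_nonneg _) (J.le_opNorm a) 2
  have h4 : t ^ 2 * ‖J a‖ ^ 2 ≤ t * ‖a‖ ^ 2 :=
    calc t ^ 2 * ‖J a‖ ^ 2 ≤ t ^ 2 * (‖J‖ ^ 2 * ‖a‖ ^ 2) := by gcongr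
      _ = t * ‖a‖ ^ 2 * (t * ‖J‖ ^ 2) := by ring
      _ ≤ t * ‖a‖ ^ 2 * 1 := by gcongr
      _ = _ := mul_one _
  linarith

theorem IsNormalStep.norm_le (hv : IsNormalStep ω c J v) (hω : 0 < ω) : ‖c + J v‖ ≤ ‖c‖ := by
  have := hv.decrease le_rfl hω.le (by simp)
  exact le_of_sq_le_sq (by linarith) (norm_nonneg _)

/-- The difference of squares factors, and the sum of the two norms is at most `2 * ‖c‖`. -/
theorem IsNormalStep.mul_le_reduction (hv : IsNormalStep ω c J v) (hω : 0 < ω) {t : ℝ} (ht : 0 ≤ t)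
    (htω : t ≤ ω) (htJ : t * ‖J‖ ^ 2 ≤ 1) :
    t * ‖J.adjoint c‖ ^ 2 ≤ 2 * ‖c‖ * (‖c‖ - ‖c + J v‖) := by
  have h1 := hv.decrease ht htω htJ
  have h2 := hv.norm_le hω
  nlinarith

/-- One step length serves all Jacobians of norm at most `K`, which makes the decrease uniform over
the iterations. -/
theorem exists_step_const (hω : 0 < ω) (K : ℝ) : ∃ t : ℝ, 0 < t ∧ t ≤ ω ∧
    ∀ J : PVec n q →L[ℝ] Vec q, ‖J‖ ≤ K → t * ‖J‖ ^ 2 ≤ 1 := by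
  refine ⟨min ω (1 / (K ^ 2 + 1)), by positivity, min_le_left _ _, fun J hJ => ?_⟩
  calc min ω (1 / (K ^ 2 + 1)) * ‖J‖ ^ 2 ≤ (1 / (K ^ 2 + 1)) * (K ^ 2 + 1) := by
        gcongr
        · exact min_le_right _ _
        · have := pow_le_pow_left₀ (norm_nonneg _) hJ 2
          linarith
    _ = 1 := by field_simp

/-- A nonstationary point of the infeasibility measure admits a positive reduction. -/
theorem IsNormalStep.reduction_pos (hv : IsNormalStep ω c J v) (hω : 0 < ω)
    (h : J.adjoint c ≠ 0) : 0 < ‖c‖ - ‖c + J v‖ := by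
  obtain ⟨t, ht, htω, htJ⟩ := exists_step_const (n := n) (q := q) hω ‖J‖
  have h1 := hv.mul_le_reduction hω ht.le htω (htJ J le_rfl)
  have h2 : 0 < ‖J.adjoint c‖ := norm_pos_iff.2 h
  have h3 : 0 < t * ‖J.adjoint c‖ ^ 2 := by positivity
  by_contra! h4
  nlinarith [norm_nonneg c]

theorem IsNormalStep.eq_zero (hv : IsNormalStep ω c J v) (h : J.adjoint c = 0) : v = 0 := by
  have := hv.2.2
  rw [h, norm_zero, mul_zero] at this
  exact norm_le_zero_iff.1 this

variable {W : PVec n q →L[ℝ] PVec n q} {g : PVec n q} {p : PVec n q × Vec q}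

theorem IsNewtonStep.tangential_mem (hp : IsNewtonStep W J g v p) : J (p.1 - v) = 0 := by
  rw [map_sub, hp.2, sub_self]

/-- The tangential step lies in the null space of `J`, so testing the first Newton equation against
it removes the multiplier. -/
theorem IsNewtonStep.inner_tangential (hp : IsNewtonStep W J g v p) :
    inner ℝ g (p.1 - v) = - inner ℝ (p.1 - v) (W (p.1 - v)) - inner ℝ (p.1 - v) (W v) := by
  have h1 : g = -(W p.1 + J.adjoint p.2) := by rw [hp.1, neg_neg]
  have h2 : W p.1 = W (p.1 - v) + W v := by rw [← map_add, sub_add_cancel]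
  rw [real_inner_comm, h1, inner_neg_right, inner_add_right, ContinuousLinearMap.adjoint_inner_right,
    hp.tangential_mem, inner_zero_left, h2, inner_add_right]
  ring

/-- Bound for the denominator of the trial merit parameter. -/
theorem IsNewtonStep.den_le (hp : IsNewtonStep W J g v p) {σW κW G : ℝ} (hσ : 0 < σW)
    (hW : ∀ w, J w = 0 → σW * ‖w‖ ^ 2 ≤ inner ℝ w (W w)) (hκ : ‖W‖ ≤ κW) (hG : ‖g‖ ≤ G) :
    inner ℝ g p.1 + (1 / 2) * inner ℝ (p.1 - v) (W (p.1 - v)) ≤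
      κW ^ 2 / (2 * σW) * ‖v‖ ^ 2 + G * ‖v‖ := by
  set u := p.1 - v with hu
  have h1 := hp.inner_tangential
  have h2 : inner ℝ g p.1 = inner ℝ g u + inner ℝ g v := by
    rw [← inner_add_right, hu, sub_add_cancel]
  have h3 := hW u hp.tangential_mem
  have h4 : inner ℝ g v ≤ G * ‖v‖ :=
    (real_inner_le_norm _ _).trans (by gcongr)
  have h5 : -inner ℝ u (W v) ≤ ‖u‖ * (κW * ‖v‖) := by
    rw [← inner_neg_right]
    refine (real_inner_le_norm _ _).trans ?_
    rw [norm_neg]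
    gcongr
    exact W.le_of_opNorm_le hκ v
  -- Young's inequality, weighted to use up exactly the half of the curvature left after adding
  -- ½uᵀWu.
  have h6 : ‖u‖ * (κW * ‖v‖) ≤ σW / 2 * ‖u‖ ^ 2 + κW ^ 2 / (2 * σW) * ‖v‖ ^ 2 := by
    have : σW / 2 * ‖u‖ ^ 2 + κW ^ 2 / (2 * σW) * ‖v‖ ^ 2 - ‖u‖ * (κW * ‖v‖)
        = (σW * ‖u‖ - κW * ‖v‖) ^ 2 / (2 * σW) := by field_simp; ring
    have h7 : 0 ≤ (σW * ‖u‖ - κW * ‖v‖) ^ 2 / (2 * σW) := by positivity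
    linarith
  rw [h2, h1]
  linarith

theorem IsNewtonStep.norm_tangential_le (hp : IsNewtonStep W J g v p) {σW κW G : ℝ} (hσ : 0 < σW)
    (hW : ∀ w, J w = 0 → σW * ‖w‖ ^ 2 ≤ inner ℝ w (W w)) (hκ : ‖W‖ ≤ κW) (hG : ‖g‖ ≤ G) :
    ‖p.1 - v‖ ≤ (G + κW * ‖v‖) / σW := by
  set u := p.1 - v with hu
  have h1 := hp.inner_tangential
  have h3 := hW u hp.tangential_mem
  have h4 : -inner ℝ g u ≤ G * ‖u‖ := by
    rw [← inner_neg_right]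
    refine (real_inner_le_norm _ _).trans ?_
    rw [norm_neg]
    gcongr
  have h5 : -inner ℝ u (W v) ≤ ‖u‖ * (κW * ‖v‖) := by
    rw [← inner_neg_right]
    refine (real_inner_le_norm _ _).trans ?_
    rw [norm_neg]
    gcongr
    exact W.le_of_opNorm_le hκ v
  rw [le_div_iff₀ hσ]
  rcases (norm_nonneg u).eq_or_lt with h | h
  · rw [← h, zero_mul]
    have := (norm_nonneg g).trans hG
    have := (norm_nonneg W).trans hκ
    positivity
  · have : (‖u‖ * σW) * ‖u‖ ≤ (G + κW * ‖v‖) * ‖u‖ := by linarith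
    exact le_of_mul_le_mul_right this h

/-- If the normal step vanishes by stationarity, the trial merit parameter is infinite. -/
theorem den_nonpos_of_stationary (hv : IsNormalStep ω c J v) (hp : IsNewtonStep W J g v p)
    {σW : ℝ} (hσ : 0 < σW) (hW : ∀ w, J w = 0 → σW * ‖w‖ ^ 2 ≤ inner ℝ w (W w))
    (h : J.adjoint c = 0) :
    inner ℝ g p.1 + (1 / 2) * inner ℝ (p.1 - v) (W (p.1 - v)) ≤ 0 := by
  have h0 := hv.eq_zero h
  have := hp.den_le hσ hW le_rfl le_rfl
  simpa [h0] using this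

/-- A zero step gives J v = 0, so the normal step achieves no reduction and Jᵀc must vanish. Both
stopping conditions then hold, whence steps of an infinite run are nonzero. -/
theorem eq_zero_of_newton_eq_zero (hv : IsNormalStep ω c J v) (hω : 0 < ω)
    (hp : IsNewtonStep W J g v p) (h : p.1 = 0) : J.adjoint c = 0 ∧ g + J.adjoint p.2 = 0 := by
  constructor
  · by_contra hne
    have h1 := hv.reduction_pos hω hne
    rw [← hp.2, h, map_zero, add_zero, sub_self] at h1
    exact lt_irrefl _ h1
  · have := hp.1
    rw [h, map_zero, zero_add] at this
    rw [this, add_neg_cancel]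

end Steps

/-! ### Norm estimates for the scaled gradient and Jacobian -/

section Basic

variable {n q : ℕ}

theorem diag_apply (s w : Vec q) (i : Fin q) : diag s w i = s i * w i := by
  simp [diag, Matrix.ofLp_toEuclideanCLM, Matrix.mulVec_diagonal]

theorem norm_diag_le (s : Vec q) : ‖diag s‖ ≤ ‖s‖ := by
  refine ContinuousLinearMap.opNorm_le_bound _ (norm_nonneg _) fun w => ?_
  refine le_of_sq_le_sq ?_ (by positivity)
  rw [EuclideanSpace.norm_sq_eq, mul_pow, EuclideanSpace.norm_sq_eq s, Finset.sum_mul]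
  refine Finset.sum_le_sum fun i _ => ?_
  rw [diag_apply, norm_mul, mul_pow]
  gcongr
  exact PiLp.norm_apply_le w i

theorem norm_fst_le (p : PVec n q) : ‖p.fst‖ ≤ ‖p‖ := by
  refine le_of_sq_le_sq ?_ (norm_nonneg _)
  rw [WithLp.prod_norm_sq_eq_of_L2]
  linarith [sq_nonneg ‖p.snd‖]

theorem norm_snd_le (p : PVec n q) : ‖p.snd‖ ≤ ‖p‖ := by
  refine le_of_sq_le_sq ?_ (norm_nonneg _)
  rw [WithLp.prod_norm_sq_eq_of_L2]
  linarith [sq_nonneg ‖p.fst‖]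

theorem norm_le_fst_add_snd (p : PVec n q) : ‖p‖ ≤ ‖p.fst‖ + ‖p.snd‖ := by
  refine le_of_sq_le_sq ?_ (by positivity)
  rw [WithLp.prod_norm_sq_eq_of_L2]
  nlinarith [norm_nonneg p.fst, norm_nonneg p.snd]

open Module in
theorem finrank_vec_le_finrank_pvec : finrank ℝ (Vec q) ≤ finrank ℝ (PVec n q) :=
  LinearMap.finrank_le_finrank_of_surjective
    (f := (WithLp.sndL 2 ℝ (Vec n) (Vec q) : PVec n q →ₗ[ℝ] Vec q))
    fun y => ⟨WithLp.toLp 2 (0, y), rfl⟩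

theorem Oracle.jac_apply (O : Oracle n q) (x : Vec n) (s : Vec q) (p : PVec n q) :
    O.jac x s p = O.J x p.fst + diag s p.snd := rfl

theorem Oracle.norm_jac_le (O : Oracle n q) (x : Vec n) (s : Vec q) :
    ‖O.jac x s‖ ≤ ‖O.J x‖ + ‖s‖ := by
  refine ContinuousLinearMap.opNorm_le_bound _ (by positivity) fun p => ?_
  rw [O.jac_apply, add_mul]
  refine norm_add_le_of_le ?_ ?_
  · exact ((O.J x).le_opNorm _).trans (by gcongr; exact norm_fst_le p)
  · exact ((diag s).le_of_opNorm_le (norm_diag_le s) _).trans (by gcongr; exact norm_snd_le p)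

theorem Oracle.norm_jac_sub_le (O Q : Oracle n q) (x : Vec n) (s : Vec q) :
    ‖O.jac x s - Q.jac x s‖ ≤ ‖O.J x - Q.J x‖ := by
  refine ContinuousLinearMap.opNorm_le_bound _ (by positivity) fun p => ?_
  have : (O.jac x s - Q.jac x s) p = (O.J x - Q.J x) p.fst := by
    rw [sub_apply, sub_apply, O.jac_apply, Q.jac_apply]
    abel
  rw [this]
  exact ((O.J x - Q.J x).le_opNorm _).trans (by gcongr; exact norm_fst_le p)

theorem Oracle.norm_grad_le (O : Oracle n q) (μ : ℝ) (x : Vec n) :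
    ‖O.grad (q := q) μ x‖ ≤ ‖O.g x‖ + ‖(WithLp.toLp 2 fun _ => -μ : Vec q)‖ :=
  norm_le_fst_add_snd _

theorem Oracle.norm_grad_sub_le (O Q : Oracle n q) (μ : ℝ) (x : Vec n) :
    ‖O.grad (q := q) μ x - Q.grad μ x‖ ≤ ‖O.g x - Q.g x‖ := by
  refine (norm_le_fst_add_snd _).trans ?_
  simp [Oracle.grad]

theorem Oracle.con_sub (O Q : Oracle n q) (x : Vec n) (s : Vec q) :
    O.con x s - Q.con x s = O.c x - Q.c x := by
  simp [Oracle.con]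

theorem norm_adjoint_eq (J : PVec n q →L[ℝ] Vec q) : ‖J.adjoint‖ = ‖J‖ :=
  LinearIsometryEquiv.norm_map _ _

end Basic

/-- Bounds on the values of an oracle along the iterates, and on the matrices `W_k` relative to
the Jacobians of the oracle. -/
structure TraceBounds {n q : ℕ} (Q : Oracle n q) (P : Params) (T : Trace n q)
    (Cc G K σW κW : ℝ) : Prop where
  Cc_pos : 0 < Cc
  σW_pos : 0 < σW
  con_le : ∀ k, ‖Q.con (T.x k) (T.s k)‖ ≤ Cc
  grad_le : ∀ k, ‖Q.grad (q := q) P.μ (T.x k)‖ ≤ G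
  jac_le : ∀ k, ‖Q.jac (T.x k) (T.s k)‖ ≤ K
  pos_def : ∀ k w, Q.jac (T.x k) (T.s k) w = 0 → σW * ‖w‖ ^ 2 ≤ inner ℝ w (T.W k w)
  W_le : ∀ k, ‖T.W k‖ ≤ κW

/-! ### Merit parameters, model reductions and step bounds along the iterates -/

section Shadow

variable {n q : ℕ} {Q : Oracle n q} {P : Params} {T : Trace n q} {B : Shadow n q} {σW : ℝ}

/-- The quantities of a run itself are those obtained along its iterates from its own oracle. -/
theorem IsInfiniteRun.isShadow (hT : IsInfiniteRun Q P T) :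
    IsShadow Q P T ⟨T.v, T.d, T.y, T.τ⟩ :=
  ⟨hT.normal, hT.newton, hT.merit_zero, hT.merit_succ⟩

/-- A positive denominator rules out Jᵀc = 0, so the normal step strictly reduces the linearized
infeasibility and the trial value is positive. -/
theorem IsShadow.updateMerit_pos (hB : IsShadow Q P T B) (hP : P.Admissible) (hσ : 0 < σW) {k : ℕ}
    (hW : ∀ w, Q.jac (T.x k) (T.s k) w = 0 → σW * ‖w‖ ^ 2 ≤ inner ℝ w (T.W k w))
    {t : ℝ} (ht : 0 < t) :
    0 < Q.updateMerit P (T.x k) (T.s k) (T.W k) (B.v k) (B.d k) t := by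
  refine nextMerit_pos hP.σ_mem.2 hP.δτ_mem.2 ht fun hden => ?_
  refine (hB.normal k).reduction_pos hP.ω_pos fun h0 => ?_
  exact absurd (den_nonpos_of_stationary (hB.normal k) (hB.newton k) hσ hW h0) (not_le.2 hden)

theorem IsShadow.τ_pos (hB : IsShadow Q P T B) (hP : P.Admissible) (hσ : 0 < σW)
    (hW : ∀ k w, Q.jac (T.x k) (T.s k) w = 0 → σW * ‖w‖ ^ 2 ≤ inner ℝ w (T.W k w)) (k : ℕ) :
    0 < B.τ k := by
  induction k with
  | zero => rw [hB.merit_zero]; exact hB.updateMerit_pos hP hσ (hW 0) hP.τinit_pos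
  | succ k ih => rw [hB.merit_succ]; exact hB.updateMerit_pos hP hσ (hW _) ih

theorem IsShadow.τ_antitone (hB : IsShadow Q P T B) (hP : P.Admissible) (hσ : 0 < σW)
    (hW : ∀ k w, Q.jac (T.x k) (T.s k) w = 0 → σW * ‖w‖ ^ 2 ≤ inner ℝ w (T.W k w)) :
    Antitone B.τ := by
  refine antitone_nat_of_succ_le fun k => ?_
  rw [hB.merit_succ]
  exact nextMerit_le hP.δτ_mem.1 (hB.τ_pos hP hσ hW k)

/-- The reduction in the model is bounded below by the squared tangential step and the reduction
of the linearized infeasibility. -/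
theorem IsShadow.le_modelRed (hB : IsShadow Q P T B) (hP : P.Admissible) (hσ : 0 < σW)
    (hW : ∀ k w, Q.jac (T.x k) (T.s k) w = 0 → σW * ‖w‖ ^ 2 ≤ inner ℝ w (T.W k w)) (k : ℕ) :
    1 / 2 * B.τ k * σW * ‖B.d k - B.v k‖ ^ 2
      + P.σ * (‖Q.con (T.x k) (T.s k)‖ - ‖Q.con (T.x k) (T.s k) + Q.jac (T.x k) (T.s k) (B.v k)‖)
      ≤ Q.modelRed P.μ (T.x k) (T.s k) (B.d k) (B.τ k) := by
  have hpos := hB.τ_pos hP hσ hW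
  have hnum := sub_nonneg.2 ((hB.normal k).norm_le hP.ω_pos)
  set num := ‖Q.con (T.x k) (T.s k)‖ - ‖Q.con (T.x k) (T.s k) + Q.jac (T.x k) (T.s k) (B.v k)‖
    with hn
  have hkey : B.τ k * (inner ℝ (Q.grad P.μ (T.x k)) (B.d k)
      + (1 / 2) * inner ℝ (B.d k - B.v k) (T.W k (B.d k - B.v k))) ≤ (1 - P.σ) * num := by
    cases k with
    | zero => rw [hB.merit_zero]; exact nextMerit_mul_le hP.σ_mem.2 hP.τinit_pos hnum
    | succ k => rw [hB.merit_succ]; exact nextMerit_mul_le hP.σ_mem.2 (hpos k) hnum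
  have h1 := hW k _ (hB.newton k).tangential_mem
  have h2 : B.τ k * (σW * ‖B.d k - B.v k‖ ^ 2)
      ≤ B.τ k * inner ℝ (B.d k - B.v k) (T.W k (B.d k - B.v k)) := by
    have := (hpos k).le
    gcongr
  -- Since J d = J v, the infeasibility part of the model reduction is that of the normal step
  -- alone.
  have h3 : Q.modelRed P.μ (T.x k) (T.s k) (B.d k) (B.τ k)
      = -(B.τ k * inner ℝ (Q.grad P.μ (T.x k)) (B.d k)) + num := by
    have : Q.jac (T.x k) (T.s k) (B.d k) = Q.jac (T.x k) (T.s k) (B.v k) := (hB.newton k).2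
    rw [Oracle.modelRed, this, hn]
    ring
  rw [h3]
  linarith

theorem IsShadow.modelRed_nonneg (hB : IsShadow Q P T B) (hP : P.Admissible) (hσ : 0 < σW)
    (hW : ∀ k w, Q.jac (T.x k) (T.s k) w = 0 → σW * ‖w‖ ^ 2 ≤ inner ℝ w (T.W k w)) (k : ℕ) :
    0 ≤ Q.modelRed P.μ (T.x k) (T.s k) (B.d k) (B.τ k) := by
  refine le_trans ?_ (hB.le_modelRed hP hσ hW k)
  have h1 := hB.τ_pos hP hσ hW k
  have h2 := sub_nonneg.2 ((hB.normal k).norm_le hP.ω_pos)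
  have h3 := hP.σ_mem.1
  positivity

variable {Cc G K κW : ℝ}

/-- Split d = u + v: curvature controls u, and the decrease of the normal step controls ‖Jᵀc‖²,
hence ‖v‖². No rank condition enters. -/
theorem IsShadow.exists_modelRed_lower (hB : IsShadow Q P T B) (hP : P.Admissible)
    (hQ : TraceBounds Q P T Cc G K σW κW) {t : ℝ} (ht : 0 < t) (hτ : ∀ k, t ≤ B.τ k) :
    ∃ ξ : ℝ, 0 < ξ ∧ ∀ k, ξ * ‖B.d k‖ ^ 2 ≤ Q.modelRed P.μ (T.x k) (T.s k) (B.d k) (B.τ k) := by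
  obtain ⟨r, hr, hrω, hrJ⟩ := exists_step_const (n := n) (q := q) hP.ω_pos K
  have hσ := hP.σ_mem.1
  have hω := hP.ω_pos
  have hC := hQ.Cc_pos
  have hsW := hQ.σW_pos
  -- The numbers `a` and `b` are the coefficients obtained for ‖u‖² and ‖v‖²; the later factor ½
  -- pays for ‖u + v‖² ≤ 2‖u‖² + 2‖v‖².
  set a := 1 / 2 * t * σW with ha
  set b := P.σ * (r / (2 * Cc * P.ω ^ 2)) with hb
  have ha0 : 0 < a := by positivity
  have hb0 : 0 < b := by positivity
  refine ⟨min a b / 2, by positivity, fun k => ?_⟩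
  refine le_trans ?_ (hB.le_modelRed hP hsW hQ.pos_def k)
  set c := Q.con (T.x k) (T.s k) with hc
  set J := Q.jac (T.x k) (T.s k) with hJ
  have hnum := sub_nonneg.2 ((hB.normal k).norm_le hP.ω_pos)
  have h1 := (hB.normal k).mul_le_reduction hP.ω_pos hr.le hrω (hrJ _ (hQ.jac_le k))
  have h2 : ‖B.v k‖ ^ 2 ≤ P.ω ^ 2 * ‖J.adjoint c‖ ^ 2 := by
    rw [← mul_pow]
    exact pow_le_pow_left₀ (norm_nonneg _) (hB.normal k).2.2 2
  have h3 : b * ‖B.v k‖ ^ 2 ≤ P.σ * (‖c‖ - ‖c + J (B.v k)‖) := by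
    rw [hb, mul_assoc]
    gcongr
    rw [div_mul_eq_mul_div, div_le_iff₀ (by positivity)]
    calc r * ‖B.v k‖ ^ 2 ≤ r * (P.ω ^ 2 * ‖J.adjoint c‖ ^ 2) := by gcongr
      _ = P.ω ^ 2 * (r * ‖J.adjoint c‖ ^ 2) := by ring
      _ ≤ P.ω ^ 2 * (2 * ‖c‖ * (‖c‖ - ‖c + J (B.v k)‖)) := by gcongr
      _ ≤ P.ω ^ 2 * (2 * Cc * (‖c‖ - ‖c + J (B.v k)‖)) := by
          gcongr
          exact hQ.con_le k
      _ = _ := by ring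
  have h4 : ‖B.d k‖ ^ 2 ≤ 2 * ‖B.d k - B.v k‖ ^ 2 + 2 * ‖B.v k‖ ^ 2 := by
    have : ‖B.d k‖ ≤ ‖B.d k - B.v k‖ + ‖B.v k‖ := by
      simpa using norm_add_le (B.d k - B.v k) (B.v k)
    have h5 := pow_le_pow_left₀ (norm_nonneg _) this 2
    nlinarith [sq_nonneg (‖B.d k - B.v k‖ - ‖B.v k‖)]
  calc min a b / 2 * ‖B.d k‖ ^ 2
      ≤ min a b / 2 * (2 * ‖B.d k - B.v k‖ ^ 2 + 2 * ‖B.v k‖ ^ 2) := by gcongr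
    _ = min a b * ‖B.d k - B.v k‖ ^ 2 + min a b * ‖B.v k‖ ^ 2 := by ring
    _ ≤ a * ‖B.d k - B.v k‖ ^ 2 + b * ‖B.v k‖ ^ 2 := by
        gcongr
        · exact min_le_left _ _
        · exact min_le_right _ _
    _ ≤ _ := by
        have h6 : a ≤ 1 / 2 * B.τ k * σW := by
          rw [ha]
          gcongr
          exact hτ k
        gcongr

theorem IsShadow.norm_d_le (hB : IsShadow Q P T B) (hP : P.Admissible)
    (hQ : TraceBounds Q P T Cc G K σW κW) (k : ℕ) :
    ‖B.d k‖ ≤ (G + κW * (P.ω * (K * Cc))) / σW + P.ω * (K * Cc) := by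
  have hσ := hQ.σW_pos
  have hω := hP.ω_pos
  have hK : 0 ≤ K := (norm_nonneg _).trans (hQ.jac_le 0)
  have hκ : 0 ≤ κW := (norm_nonneg _).trans (hQ.W_le 0)
  have hv : ‖B.v k‖ ≤ P.ω * (K * Cc) := by
    refine (hB.normal k).2.2.trans ?_
    gcongr
    refine (ContinuousLinearMap.le_opNorm _ _).trans ?_
    rw [norm_adjoint_eq]
    gcongr
    · exact hQ.jac_le k
    · exact hQ.con_le k
  have hu := (hB.newton k).norm_tangential_le hσ (hQ.pos_def k) (hQ.W_le k) (hQ.grad_le k)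
  calc ‖B.d k‖ = ‖(B.d k - B.v k) + B.v k‖ := by rw [sub_add_cancel]
    _ ≤ ‖B.d k - B.v k‖ + ‖B.v k‖ := norm_add_le _ _
    _ ≤ (G + κW * ‖B.v k‖) / σW + ‖B.v k‖ := by gcongr
    _ ≤ _ := by gcongr

/-- If the Jacobians eventually have full row rank uniformly, the merit parameter is eventually
constant. -/
theorem IsShadow.τ_eventually_const (hB : IsShadow Q P T B) (hP : P.Admissible)
    (hQ : TraceBounds Q P T Cc G K σW κW) {N : ℕ} {β : ℝ} (hβ : 0 < β)
    (hJ : ∀ k, N ≤ k → ∀ y, β * ‖y‖ ≤ ‖(Q.jac (T.x k) (T.s k)).adjoint y‖) :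
    ∃ M, ∀ k, M ≤ k → B.τ k = B.τ M := by
  obtain ⟨r, hr, hrω, hrJ⟩ := exists_step_const (n := n) (q := q) hP.ω_pos K
  have hσ := hP.σ_mem
  have hω := hP.ω_pos
  have hC := hQ.Cc_pos
  have hsW := hQ.σW_pos
  have hpos := hB.τ_pos hP hsW hQ.pos_def
  have hK : 0 ≤ K := (norm_nonneg _).trans (hQ.jac_le 0)
  have hG : 0 ≤ G := (norm_nonneg _).trans (hQ.grad_le 0)
  set V := P.ω * (K * Cc) with hV
  -- `D` bounds the ratio of the trial denominator to ω‖Jᵀc‖; the summand 1 only secures positivity.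
  set D := κW ^ 2 / (2 * σW) * V + G + 1 with hD
  have hD0 : 0 < D := by positivity
  -- Numerator and denominator of the trial value are both compared with multiples of ‖Jᵀc‖, which
  -- cancels in this quotient.
  set t := (1 - P.σ) * (r * β / 2) / (D * P.ω) with htdef
  have h1σ : 0 < 1 - P.σ := by linarith [hσ.2]
  have ht : 0 < t := by positivity
  have htrial : ∀ k, N ≤ k →
      0 < inner ℝ (Q.grad P.μ (T.x k)) (B.d k)
        + (1 / 2) * inner ℝ (B.d k - B.v k) (T.W k (B.d k - B.v k)) →
      t ≤ (1 - P.σ) * (‖Q.con (T.x k) (T.s k)‖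
          - ‖Q.con (T.x k) (T.s k) + Q.jac (T.x k) (T.s k) (B.v k)‖)
        / (inner ℝ (Q.grad P.μ (T.x k)) (B.d k)
          + (1 / 2) * inner ℝ (B.d k - B.v k) (T.W k (B.d k - B.v k))) := by
    intro k hk hden
    rw [le_div_iff₀ hden]
    have hnum := (hB.normal k).mul_le_reduction hP.ω_pos hr.le hrω (hrJ _ (hQ.jac_le k))
    have hdle := (hB.newton k).den_le hsW (hQ.pos_def k) (hQ.W_le k) (hQ.grad_le k)
    have hvn := (hB.normal k).2.2
    have hfull := hJ k hk (Q.con (T.x k) (T.s k))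
    have hcle := hQ.con_le k
    have hJle := hQ.jac_le k
    have hnn := sub_nonneg.2 ((hB.normal k).norm_le hP.ω_pos)
    have hane : (Q.jac (T.x k) (T.s k)).adjoint (Q.con (T.x k) (T.s k)) ≠ 0 := fun h0 =>
      absurd (den_nonpos_of_stationary (hB.normal k) (hB.newton k) hsW (hQ.pos_def k) h0)
        (not_le.2 hden)
    have hale : ‖(Q.jac (T.x k) (T.s k)).adjoint (Q.con (T.x k) (T.s k))‖ ≤ K * Cc := by
      refine (ContinuousLinearMap.le_opNorm _ _).trans ?_
      rw [norm_adjoint_eq]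
      gcongr
    set a := ‖(Q.jac (T.x k) (T.s k)).adjoint (Q.con (T.x k) (T.s k))‖
    set num := ‖Q.con (T.x k) (T.s k)‖
      - ‖Q.con (T.x k) (T.s k) + Q.jac (T.x k) (T.s k) (B.v k)‖
    have ha0 : 0 < a := norm_pos_iff.2 hane
    have hvV : ‖B.v k‖ ≤ V := hvn.trans (by rw [hV]; gcongr)
    have hden2 : inner ℝ (Q.grad P.μ (T.x k)) (B.d k)
        + (1 / 2) * inner ℝ (B.d k - B.v k) (T.W k (B.d k - B.v k)) ≤ D * (P.ω * a) :=
      calc _ ≤ κW ^ 2 / (2 * σW) * ‖B.v k‖ ^ 2 + G * ‖B.v k‖ := hdle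
        _ = (κW ^ 2 / (2 * σW) * ‖B.v k‖ + G) * ‖B.v k‖ := by ring
        _ ≤ D * (P.ω * a) := by
            gcongr
            rw [hD]
            have : κW ^ 2 / (2 * σW) * ‖B.v k‖ ≤ κW ^ 2 / (2 * σW) * V := by gcongr
            linarith
    -- Full rank enters here: β‖c‖ ≤ ‖Jᵀc‖ turns the quadratic decrease in ‖Jᵀc‖ into a linear one.
    have hnum2 : r * β / 2 * a ≤ num := by
      have h1 : (r * β * a) * a ≤ (2 * num) * a :=
        calc (r * β * a) * a = β * (r * a ^ 2) := by ring
          _ ≤ β * (2 * ‖Q.con (T.x k) (T.s k)‖ * num) := by gcongr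
          _ = (β * ‖Q.con (T.x k) (T.s k)‖) * (2 * num) := by ring
          _ ≤ a * (2 * num) := by gcongr
          _ = _ := by ring
      have := le_of_mul_le_mul_right h1 ha0
      linarith
    calc t * _ ≤ t * (D * (P.ω * a)) := by gcongr
      _ = (1 - P.σ) * (r * β / 2 * a) := by rw [htdef]; field_simp
      _ ≤ _ := by gcongr
  have hlow : ∀ k, N ≤ k → min (B.τ N) ((1 - P.δτ) * t) ≤ B.τ k := by
    intro k hk
    induction k, hk using Nat.le_induction with
    | base => exact min_le_left _ _
    | succ k hk ih =>
      have := le_nextMerit (τ := B.τ k) hP.δτ_mem ht (htrial (k + 1) (hk.trans (Nat.le_succ k)))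
      rw [hB.merit_succ]
      exact (le_min ih (min_le_right _ _)).trans this
  refine eventually_const_of_eq_or_le_mul (N := N) hP.δτ_mem.1 hP.δτ_mem.2 ?_ hlow fun k => ?_
  · have := hP.δτ_mem.2
    exact lt_min (hpos N) (mul_pos (by linarith) ht)
  · rw [hB.merit_succ]
    exact nextMerit_eq_or_le

end Shadow

/-! ### Descent and noise estimates for the merit function -/

section Descent

variable {n q : ℕ}

/-- Decrease of the logarithmic barrier along a scaled slack step. -/
theorem barrier_descent {s w : Vec q} {a η : ℝ} (hη : η < 1) (hs : ∀ i, 0 < s i)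
    (hw : ∀ i, (1 - η) * s i ≤ (s + a • diag s w) i) :
    -∑ i, Real.log ((s + a • diag s w) i) ≤
      -∑ i, Real.log (s i) - a * ∑ i, w i + a ^ 2 * ‖w‖ ^ 2 / (1 - η) := by
  have h : ∀ i, Real.log (s i) + (a * w i - (a * w i) ^ 2 / (1 - η))
      ≤ Real.log ((s + a • diag s w) i) := by
    intro i
    -- The scaled slack step is multiplicative, so the logarithm splits and the boundary rule reads
    -- a wᵢ ≥ -η.
    have h1 : (s + a • diag s w) i = s i * (1 + a * w i) := by
      simp only [PiLp.add_apply, PiLp.smul_apply, diag_apply, smul_eq_mul]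
      ring
    have h2 := hw i
    rw [h1, mul_comm] at h2
    have h3 : -η ≤ a * w i := by linarith [le_of_mul_le_mul_left h2 (hs i)]
    rw [h1, Real.log_mul (hs i).ne' (by linarith)]
    linarith [sub_sq_div_le_log_one_add hη h3]
  have h4 := Finset.sum_le_sum fun i (_ : i ∈ Finset.univ) => h i
  have h5 : ∑ i, (Real.log (s i) + (a * w i - (a * w i) ^ 2 / (1 - η)))
      = ∑ i, Real.log (s i) + a * ∑ i, w i - a ^ 2 * ‖w‖ ^ 2 / (1 - η) := by
    rw [Finset.sum_add_distrib, Finset.sum_sub_distrib, ← Finset.mul_sum, ← Finset.sum_div]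
    simp only [mul_pow]
    rw [← Finset.mul_sum, EuclideanSpace.norm_sq_eq]
    simp only [Real.norm_eq_abs, sq_abs]
    ring
  linarith

theorem inner_grad (Q : Oracle n q) (μ : ℝ) (x : Vec n) (d : PVec n q) :
    inner ℝ (Q.grad μ x) d = inner ℝ (Q.g x) d.fst - μ * ∑ i, d.snd i := by
  rw [WithLp.prod_inner_apply]
  have : inner ℝ (WithLp.toLp 2 fun _ => -μ : Vec q) d.snd = -(μ * ∑ i, d.snd i) := by
    simp [PiLp.inner_apply, Finset.mul_sum, mul_comm]
  rw [sub_eq_add_neg, ← this]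
  rfl

theorem norm_fderiv_sub_eq_norm_gradient_sub (f : Vec n → ℝ) (x x' : Vec n) :
    ‖fderiv ℝ f x - fderiv ℝ f x'‖ = ‖gradient f x - gradient f x'‖ := by
  rw [← toDual_gradient, ← toDual_gradient, ← map_sub, LinearIsometryEquiv.norm_map]

/-- Upper bound for the exact merit function along a step, in terms of the model reduction. -/
theorem exact_merit_descent {fbar : Vec n → ℝ} {cbar : Vec n → Vec q} {P : Params}
    (hP : P.Admissible) {X : Set (Vec n)} (hX : IsOpen X) (hXc : Convex ℝ X)
    (hf : ContDiffOn ℝ 1 fbar X) (hc : ContDiffOn ℝ 1 cbar X) {Lg LJ : ℝ}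
    (hLg : ∀ x ∈ X, ∀ x' ∈ X, ‖gradient fbar x - gradient fbar x'‖ ≤ Lg * ‖x - x'‖)
    (hLJ : ∀ x ∈ X, ∀ x' ∈ X, ‖fderiv ℝ cbar x - fderiv ℝ cbar x'‖ ≤ LJ * ‖x - x'‖)
    {x : Vec n} {s : Vec q} {d : PVec n q} {a τ : ℝ} (hs : ∀ i, 0 < s i) (ha : 0 ≤ a) (ha1 : a ≤ 1)
    (hτ : 0 < τ) (hx : x ∈ X) (hxa : x + a • d.fst ∈ X)
    (hsa : ∀ i, (1 - P.ηs) * s i ≤ (s + a • diag s d.snd) i) :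
    (exactOracle fbar cbar).merit P.μ (x + a • d.fst) (s + a • diag s d.snd) τ ≤
      (exactOracle fbar cbar).merit P.μ x s τ
        - a * (exactOracle fbar cbar).modelRed P.μ x s d τ + ξ₀ P Lg LJ τ * a ^ 2 * ‖d‖ ^ 2 := by
  have hη := hP.ηs_mem.2
  have hμ := hP.μ_pos
  have h1η : 0 < 1 - P.ηs := by linarith
  have hf1 : fbar (x + a • d.fst) ≤
      fbar x + a * inner ℝ (gradient fbar x) d.fst + Lg / 2 * (a ^ 2 * ‖d.fst‖ ^ 2) := by
    have := norm_taylor_le_of_lipschitz hXc hX hf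
      (fun y hy y' hy' => (norm_fderiv_sub_eq_norm_gradient_sub fbar y y').le.trans
        (hLg y hy y' hy')) hx hxa
    rw [norm_smul, mul_pow, Real.norm_eq_abs a, sq_abs, map_smul, smul_eq_mul] at this
    rw [inner_gradient_left]
    linarith [(abs_le.1 (Real.norm_eq_abs _ ▸ this)).2]
  have hlog := barrier_descent hη hs hsa
  have hc1 : ‖cbar (x + a • d.fst) + (s + a • diag s d.snd)‖ ≤
      (1 - a) * ‖cbar x + s‖ + a * ‖cbar x + s + (fderiv ℝ cbar x d.fst + diag s d.snd)‖
        + LJ / 2 * (a ^ 2 * ‖d.fst‖ ^ 2) := by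
    have h1 := norm_taylor_le_of_lipschitz hXc hX hc hLJ hx hxa
    rw [norm_smul, mul_pow, Real.norm_eq_abs a, sq_abs, map_smul] at h1
    -- A convex combination of c and c + J d plus the Taylor remainder; convexity of the norm then
    -- gives the model decrease.
    have h2 : cbar (x + a • d.fst) + (s + a • diag s d.snd)
        = (1 - a) • (cbar x + s) + a • (cbar x + s + (fderiv ℝ cbar x d.fst + diag s d.snd))
          + (cbar (x + a • d.fst) - cbar x - a • fderiv ℝ cbar x d.fst) := by module
    rw [h2]
    refine norm_add_le_of_le (norm_add_le_of_le ?_ ?_) h1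
    · rw [norm_smul, Real.norm_of_nonneg (by linarith)]
    · rw [norm_smul, Real.norm_of_nonneg ha]
  have hm : (exactOracle fbar cbar).modelRed P.μ x s d τ
      = -τ * (inner ℝ (gradient fbar x) d.fst - P.μ * ∑ i, d.snd i) + ‖cbar x + s‖
        - ‖cbar x + s + (fderiv ℝ cbar x d.fst + diag s d.snd)‖ := by
    rw [Oracle.modelRed, inner_grad]
    rfl
  have hquad : τ * (Lg / 2 * (a ^ 2 * ‖d.fst‖ ^ 2)) + LJ / 2 * (a ^ 2 * ‖d.fst‖ ^ 2)
      + τ * (P.μ * (a ^ 2 * ‖d.snd‖ ^ 2 / (1 - P.ηs))) ≤ ξ₀ P Lg LJ τ * a ^ 2 * ‖d‖ ^ 2 := by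
    rw [WithLp.prod_norm_sq_eq_of_L2]
    calc _ = (1 / 2) * (τ * Lg + LJ) * (a ^ 2 * ‖d.fst‖ ^ 2)
          + τ * P.μ / (1 - P.ηs) * (a ^ 2 * ‖d.snd‖ ^ 2) := by field_simp
      _ ≤ ξ₀ P Lg LJ τ * (a ^ 2 * ‖d.fst‖ ^ 2) + ξ₀ P Lg LJ τ * (a ^ 2 * ‖d.snd‖ ^ 2) := by
          gcongr
          · exact le_max_left _ _
          · exact le_max_right _ _
      _ = _ := by ring
  have e1 : (exactOracle fbar cbar).merit P.μ (x + a • d.fst) (s + a • diag s d.snd) τ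
      = τ * fbar (x + a • d.fst) + τ * (P.μ * (-∑ i, Real.log ((s + a • diag s d.snd) i)))
        + ‖cbar (x + a • d.fst) + (s + a • diag s d.snd)‖ := by
    simp only [Oracle.merit, Oracle.obj, Oracle.con, exactOracle]
    ring
  have e2 : (exactOracle fbar cbar).merit P.μ x s τ
      = τ * fbar x + τ * (P.μ * (-∑ i, Real.log (s i))) + ‖cbar x + s‖ := by
    simp only [Oracle.merit, Oracle.obj, Oracle.con, exactOracle]
    ring
  have i1 := mul_le_mul_of_nonneg_left hf1 hτ.le
  have i2 := mul_le_mul_of_nonneg_left (mul_le_mul_of_nonneg_left hlog hμ.le) hτ.le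
  rw [e1, e2, hm]
  linarith

theorem abs_merit_sub_le (O Q : Oracle n q) {μ τ εf εc : ℝ} (hτ : 0 < τ) {x : Vec n} (s : Vec q)
    (hf : |Q.f x - O.f x| ≤ εf) (hc : ‖Q.c x - O.c x‖ ≤ εc) :
    |Q.merit μ x s τ - O.merit μ x s τ| ≤ τ * εf + εc := by
  have h1 : Q.merit μ x s τ - O.merit μ x s τ
      = τ * (Q.f x - O.f x) + (‖Q.con x s‖ - ‖O.con x s‖) := by
    simp only [Oracle.merit, Oracle.obj]
    ring
  rw [h1]
  refine (abs_add_le _ _).trans (add_le_add ?_ ?_)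
  · rw [abs_mul, abs_of_pos hτ]
    gcongr
  · refine (abs_norm_sub_norm_le _ _).trans ?_
    rwa [Oracle.con_sub]

/-- Increasing slacks to `-c_I(x)` where they are smaller does not increase the merit function. -/
theorem merit_slack_reset_le (O : Oracle n q) {μ τ : ℝ} (hμ : 0 < μ) (hτ : 0 < τ) {x : Vec n}
    {s s' : Vec q} (hs : ∀ i, 0 < s i) (h : ∀ i, s' i = max (s i) (-(O.c x i))) :
    O.merit μ x s' τ ≤ O.merit μ x s τ := by
  have h1 : ‖O.con x s'‖ ≤ ‖O.con x s‖ := by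
    refine le_of_sq_le_sq ?_ (norm_nonneg _)
    rw [EuclideanSpace.norm_sq_eq, EuclideanSpace.norm_sq_eq]
    refine Finset.sum_le_sum fun i _ => ?_
    simp only [Oracle.con, PiLp.add_apply, Real.norm_eq_abs, sq_abs, h i]
    -- Where the reset acts, the component of the constraint becomes 0; elsewhere it is unchanged.
    rcases le_total (s i) (-(O.c x i)) with h2 | h2
    · rw [max_eq_right h2]
      nlinarith [sq_nonneg (O.c x i + s i)]
    · rw [max_eq_left h2]
  have h2 : ∑ i, Real.log (s i) ≤ ∑ i, Real.log (s' i) :=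
    Finset.sum_le_sum fun i _ => Real.log_le_log (hs i) (by rw [h i]; exact le_max_left _ _)
  have h3 := mul_le_mul_of_nonneg_left (mul_le_mul_of_nonneg_left h2 hμ.le) hτ.le
  simp only [Oracle.merit, Oracle.obj]
  linarith

end Descent

/-! ### The line search -/

section Run

variable {n q : ℕ} {O : Oracle n q} {P : Params} {T : Trace n q}

theorem IsInfiniteRun.αmax_pos (hT : IsInfiniteRun O P T) (k : ℕ) : 0 < T.αmax k :=
  (hT.boundary k).1.1

/-- The slack is affine in the step size, and the boundary rule holds at 0 and at `αmax`. -/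
theorem IsInfiniteRun.slackAt_ge (hT : IsInfiniteRun O P T) (hP : P.Admissible) {k : ℕ}
    (hs : ∀ i, 0 < T.s k i) {a : ℝ} (ha : 0 ≤ a) (ha' : a ≤ T.αmax k) (i : Fin q) :
    (1 - P.ηs) * T.s k i ≤ T.slackAt k a i := by
  have h1 := (hT.boundary k).1.2.2 i
  have hpos := hT.αmax_pos k
  simp only [Trace.slackAt, PiLp.add_apply, PiLp.smul_apply, smul_eq_mul] at h1 ⊢
  have h2 : 0 < P.ηs * T.s k i := mul_pos hP.ηs_mem.1 (hs i)
  set w := diag (T.s k) (T.d k).snd i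
  rcases le_total 0 w with h3 | h3
  · nlinarith [mul_nonneg ha h3]
  · nlinarith [mul_le_mul_of_nonpos_right ha' h3]

theorem IsInfiniteRun.α_mem (hT : IsInfiniteRun O P T) (k : ℕ) :
    0 < T.α k ∧ T.α k ≤ T.αmax k := by
  obtain ⟨j, -, hj⟩ := hT.line_search k
  have := hT.αmax_pos k
  rw [hj]
  exact ⟨by positivity, mul_le_of_le_one_left this.le (pow_le_one₀ (by norm_num) (by norm_num))⟩

theorem IsInfiniteRun.slack_pos (hT : IsInfiniteRun O P T) (hP : P.Admissible) (k : ℕ) :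
    ∀ i, 0 < T.s k i := by
  induction k with
  | zero => exact hT.slack_init
  | succ k ih =>
    intro i
    rw [hT.slack_reset]
    refine lt_of_lt_of_le ?_ (le_max_left _ _)
    refine lt_of_lt_of_le ?_ (hT.slackAt_ge hP ih (hT.α_mem k).1.le (hT.α_mem k).2 i)
    exact mul_pos (by linarith [hP.ηs_mem.2]) (ih i)

theorem IsInfiniteRun.d_ne_zero (hT : IsInfiniteRun O P T) (hP : P.Admissible) (k : ℕ) :
    T.d k ≠ 0 := by
  intro h
  have h1 := eq_zero_of_newton_eq_zero (hT.normal k) hP.ω_pos (hT.newton k) h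
  exact hT.no_stationary_stop k h1

/-- If the relaxed Armijo condition holds for all step sizes up to `a`, then the accepted step size
is at least `a / 2`. -/
theorem IsInfiniteRun.half_le_α (hT : IsInfiniteRun O P T) {k : ℕ} {a : ℝ} (ha : a ≤ T.αmax k)
    (h : ∀ b, 0 < b → b ≤ a → T.Armijo O P k b) : a / 2 ≤ T.α k := by
  obtain ⟨j, hj, hα⟩ := hT.line_search k
  have hpos := hT.αmax_pos k
  rcases j with _ | j
  · rw [hα, pow_zero, one_mul]
    linarith
  -- After at least one backtrack, the previous step size, twice the accepted one, was rejected and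
  -- so exceeds `a`.
  · have h1 : ¬ T.Armijo O P k ((1 / 2 : ℝ) ^ j * T.αmax k) := fun hA =>
      absurd (hj.2 hA) (by simp)
    have h2 : a < (1 / 2 : ℝ) ^ j * T.αmax k := by
      by_contra! h3
      exact h1 (h _ (by positivity) h3)
    rw [hα, pow_succ]
    linarith

theorem IsInfiniteRun.armijo_α (hT : IsInfiniteRun O P T) (k : ℕ) : T.Armijo O P k (T.α k) := by
  obtain ⟨j, hj, hα⟩ := hT.line_search k
  rw [hα]
  exact hj.1

/-- The merit function value after the slack reset satisfies the relaxed Armijo condition. -/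
theorem IsInfiniteRun.merit_succ_le (hT : IsInfiniteRun O P T) (hP : P.Admissible) {k : ℕ}
    (hτ : 0 < T.τ k) :
    O.merit P.μ (T.x (k + 1)) (T.s (k + 1)) (T.τ k) ≤
      O.merit P.μ (T.x k) (T.s k) (T.τ k)
        - P.ηφ * T.α k * O.modelRed P.μ (T.x k) (T.s k) (T.d k) (T.τ k)
        + (2 + P.ζ) * T.ε P k := by
  refine le_trans ?_ (hT.armijo_α k)
  rw [← hT.x_succ]
  refine merit_slack_reset_le O hP.μ_pos hτ (fun i => ?_) (hT.slack_reset k)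
  refine lt_of_lt_of_le ?_
    (hT.slackAt_ge hP (hT.slack_pos hP k) (hT.α_mem k).1.le (hT.α_mem k).2 i)
  exact mul_pos (by linarith [hP.ηs_mem.2]) (hT.slack_pos hP k i)

end Run

/-! ### Errors in the model reduction -/

section Errors

variable {n q : ℕ} (Obar O : Oracle n q) (P : Params) (T : Trace n q) (B : Shadow n q) (k : ℕ)

/-- `E₂` is the effect of replacing the noiseless step and merit parameter by the actual ones in the
exact model; `E₁` is the subsequent effect of replacing exact data by noisy data. -/
theorem modelRed_eq_statMeas_add_E₂ :
    Obar.modelRed P.μ (T.x k) (T.s k) (T.d k) (T.τ k)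
      = statMeas Obar P T B k (B.τ k) + E₂ Obar P T B k := by
  have hd : T.d k = B.d k + errD T B k := by simp [errD]
  have hτ : T.τ k = B.τ k + errτ T B k := by simp [errτ]
  rw [hd, hτ]
  simp only [statMeas, E₂, Oracle.modelRed, inner_add_right, map_add, ← add_assoc]
  ring

theorem modelRed_eq_modelRed_add_E₁ :
    O.modelRed P.μ (T.x k) (T.s k) (T.d k) (T.τ k)
      = Obar.modelRed P.μ (T.x k) (T.s k) (T.d k) (T.τ k) + E₁ Obar O P T B k := by
  have hd : T.d k = B.d k + errD T B k := by simp [errD]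
  have hτ : T.τ k = B.τ k + errτ T B k := by simp [errτ]
  have hg : O.grad P.μ (T.x k) = Obar.grad P.μ (T.x k) + errG Obar O P T k := by simp [errG]
  have hc : O.con (T.x k) (T.s k) = Obar.con (T.x k) (T.s k) + errC Obar O T k := by simp [errC]
  have hJ : O.jac (T.x k) (T.s k) = Obar.jac (T.x k) (T.s k) + errJ Obar O T k := by simp [errJ]
  have hv : Obar.con (T.x k) (T.s k) + errC Obar O T k
      + (Obar.jac (T.x k) (T.s k) + errJ Obar O T k) (B.d k + errD T B k)
      = Obar.con (T.x k) (T.s k) + Obar.jac (T.x k) (T.s k) (B.d k)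
        + Obar.jac (T.x k) (T.s k) (errD T B k) + errC Obar O T k
        + errJ Obar O T k (B.d k) + errJ Obar O T k (errD T B k) := by
    rw [add_apply, map_add, map_add]
    abel
  simp only [Oracle.modelRed, E₁]
  rw [hg, hc, hJ, hd, hτ, hv]
  simp only [inner_add_left, inner_add_right, map_add, ← add_assoc]
  ring

variable {Obar O P T B k}

/-- Constraint noise enters both differences of norms, hence `2 * εc`; gradient and Jacobian noise
act on the actual step. -/
theorem abs_E₁_le {εg εc εJ τ₀ : ℝ} (hτ : 0 < T.τ k) (hτ₀ : T.τ k ≤ τ₀)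
    (hg : ‖errG Obar O P T k‖ ≤ εg) (hc : ‖errC Obar O T k‖ ≤ εc)
    (hJ : ‖errJ Obar O T k‖ ≤ εJ) :
    |E₁ Obar O P T B k| ≤ (τ₀ * εg + εJ) * ‖T.d k‖ + 2 * εc := by
  have hd : B.d k + errD T B k = T.d k := by simp [errD]
  have ht : B.τ k + errτ T B k = T.τ k := by simp [errτ]
  have hεg := (norm_nonneg _).trans hg
  have hτ₀' : 0 ≤ τ₀ := hτ.le.trans hτ₀
  simp only [E₁]
  rw [ht, hd, abs_le]
  set cb := Obar.con (T.x k) (T.s k)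
  set r := cb + Obar.jac (T.x k) (T.s k) (B.d k) + Obar.jac (T.x k) (T.s k) (errD T B k)
  have h1 : |T.τ k * inner ℝ (errG Obar O P T k) (T.d k)| ≤ τ₀ * (εg * ‖T.d k‖) := by
    rw [abs_mul, abs_of_pos hτ]
    have := (abs_real_inner_le_norm (errG Obar O P T k) (T.d k)).trans
      (mul_le_mul_of_nonneg_right hg (norm_nonneg _))
    gcongr
  have h2 : |‖cb + errC Obar O T k‖ - ‖cb‖| ≤ εc := by
    refine (abs_norm_sub_norm_le _ _).trans ?_
    simpa using hc
  have h3 : |‖r + errC Obar O T k + errJ Obar O T k (B.d k) + errJ Obar O T k (errD T B k)‖ - ‖r‖|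
      ≤ εc + εJ * ‖T.d k‖ := by
    refine (abs_norm_sub_norm_le _ _).trans ?_
    have : r + errC Obar O T k + errJ Obar O T k (B.d k) + errJ Obar O T k (errD T B k) - r
        = errC Obar O T k + errJ Obar O T k (T.d k) := by
      rw [← hd, map_add]
      abel
    rw [this]
    exact norm_add_le_of_le hc ((errJ Obar O T k).le_of_opNorm_le hJ _)
  rw [abs_le] at h1 h2 h3
  constructor <;> linarith [h1.1, h1.2, h2.1, h2.2, h3.1, h3.2]

theorem abs_E₂_le {G K ε τ₀ τ₁ : ℝ} (hτ : 0 < T.τ k) (hτ₀ : T.τ k ≤ τ₀) (hB : 0 < B.τ k)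
    (hB₀ : B.τ k ≤ τ₁) (hg : ‖Obar.grad (q := q) P.μ (T.x k)‖ ≤ G)
    (hJ : ‖Obar.jac (T.x k) (T.s k)‖ ≤ K) (hd : ‖T.d k - B.d k‖ ≤ ε) :
    |E₂ Obar P T B k| ≤ (τ₀ * G + K) * ε + max τ₀ τ₁ * G * ‖B.d k‖ := by
  have ht : B.τ k = T.τ k - errτ T B k := by simp [errτ]
  have hG := (norm_nonneg _).trans hg
  have hτ₀' : 0 ≤ τ₀ := hτ.le.trans hτ₀
  have hmax : 0 ≤ max τ₀ τ₁ := hτ₀'.trans (le_max_left _ _)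
  have hK := (norm_nonneg _).trans hJ
  have hε : ‖errD T B k‖ ≤ ε := hd
  set e := errD T B k
  set g := Obar.grad (q := q) P.μ (T.x k)
  set r := Obar.con (T.x k) (T.s k) + Obar.jac (T.x k) (T.s k) (B.d k)
  -- Merging the two terms in ḡᵀε_d leaves the coefficient τ_k, which is at most `τ₀`.
  have h0 : E₂ Obar P T B k = -(T.τ k * inner ℝ g e) - errτ T B k * inner ℝ g (B.d k)
      - (‖r + Obar.jac (T.x k) (T.s k) e‖ - ‖r‖) := by
    simp only [E₂]
    rw [ht]
    ring
  have h1 : |T.τ k * inner ℝ g e| ≤ τ₀ * (G * ε) := by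
    rw [abs_mul, abs_of_pos hτ]
    have := (abs_real_inner_le_norm g e).trans (mul_le_mul hg hε (norm_nonneg _) hG)
    gcongr
  have h2 : |errτ T B k * inner ℝ g (B.d k)| ≤ max τ₀ τ₁ * (G * ‖B.d k‖) := by
    rw [abs_mul]
    have i1 := (abs_real_inner_le_norm g (B.d k)).trans
      (mul_le_mul_of_nonneg_right hg (norm_nonneg _))
    have i2 : |errτ T B k| ≤ max τ₀ τ₁ := by
      rw [abs_le]
      constructor <;> linarith [le_max_right τ₀ τ₁, le_max_left τ₀ τ₁]
    gcongr
  have h3 : |‖r + Obar.jac (T.x k) (T.s k) e‖ - ‖r‖| ≤ K * ε := by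
    refine (abs_norm_sub_norm_le _ _).trans ?_
    rw [add_sub_cancel_left]
    exact ((Obar.jac (T.x k) (T.s k)).le_of_opNorm_le hJ _).trans (by gcongr)
  rw [h0]
  rw [abs_le] at h1 h2 h3 ⊢
  constructor <;> linarith [h1.1, h1.2, h2.1, h2.2, h3.1, h3.2]

end Errors

/-! ### The contradiction argument and the iteration-independent bounds -/

section Main

variable {n q : ℕ} {fbar : Vec n → ℝ} {cbar : Vec n → Vec q} {O : Oracle n q} {P : Params}
  {T : Trace n q} {B : Shadow n q} {εg εJ : ℝ} {X : Set (Vec n)} {Lg LJ : ℝ}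

theorem exists_traceBounds {Q : Oracle n q} {σW κW : ℝ} (hx : ∀ k, T.x k ∈ X)
    (hs : BoundedSlacks T)
    (hc : ∃ b, ∀ x ∈ X, ‖Q.c x‖ ≤ b) (hg : ∃ b, ∀ x ∈ X, ‖Q.g x‖ ≤ b)
    (hJ : ∃ b, ∀ x ∈ X, ‖Q.J x‖ ≤ b) (hσ : 0 < σW)
    (hW : ∀ k w, Q.jac (T.x k) (T.s k) w = 0 → σW * ‖w‖ ^ 2 ≤ inner ℝ w (T.W k w))
    (hκ : ∀ k, ‖T.W k‖ ≤ κW) :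
    ∃ Cc G K, TraceBounds Q P T Cc G K σW κW := by
  obtain ⟨b, hb, hsb⟩ := hs
  obtain ⟨bc, hbc⟩ := hc
  obtain ⟨bg, hbg⟩ := hg
  obtain ⟨bJ, hbJ⟩ := hJ
  have hbc0 : 0 ≤ bc := (norm_nonneg _).trans (hbc _ (hx 0))
  exact ⟨bc + b, bg + ‖(WithLp.toLp 2 fun _ => -P.μ : Vec q)‖, bJ + b,
    { Cc_pos := by positivity
      σW_pos := hσ
      con_le := fun k => norm_add_le_of_le (hbc _ (hx k)) (hsb k)
      grad_le := fun k => (Q.norm_grad_le P.μ _).trans (by gcongr; exact hbg _ (hx k))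
      jac_le := fun k => (Q.norm_jac_le _ _).trans (add_le_add (hbJ _ (hx k)) (hsb k))
      pos_def := hW
      W_le := hκ }⟩

theorem bounded_of_near {E F : Type*} [SeminormedAddCommGroup F] {f g : E → F} {X : Set E} {ε : ℝ}
    (hf : ∃ b, ∀ x ∈ X, ‖f x‖ ≤ b) (h : ∀ x ∈ X, ‖f x - g x‖ ≤ ε) :
    ∃ b, ∀ x ∈ X, ‖g x‖ ≤ b := by
  obtain ⟨b, hb⟩ := hf
  refine ⟨b + ε, fun x hx => ?_⟩
  have : g x = f x - (f x - g x) := by abel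
  rw [this]
  exact (norm_sub_le _ _).trans (add_le_add (hb x hx) (h x hx))

/-- The relaxed Armijo condition holds for all step sizes up to the threshold `α̂_k`, if the
noise in the model reduction is small compared to the exact model reduction. -/
theorem armijo_of_le_αhat (hP : P.Admissible) (hT : IsInfiniteRun O P T)
    (hData : RegularData fbar cbar O P εg εJ X Lg LJ T) {k : ℕ} (hτ : 0 < T.τ k)
    (hM : 2 * (P.ηφ * E₁ (exactOracle fbar cbar) O P T B k
        - (1 - P.ηφ) * E₂ (exactOracle fbar cbar) P T B k) / (1 - P.ηφ)
      ≤ statMeas (exactOracle fbar cbar) P T B k (B.τ k))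
    {a : ℝ} (ha : 0 < a) (haα : a ≤ αhat (exactOracle fbar cbar) P T B k Lg LJ) :
    T.Armijo O P k a := by
  set Ob := exactOracle fbar cbar
  have hη := hP.ηφ_mem
  have h1η : 0 < 1 - P.ηφ := by linarith [hη.2]
  have haα1 := haα.trans (min_le_left _ _)
  have haα2 := haα.trans (min_le_right _ _)
  have hpos := hT.αmax_pos k
  have hd : B.d k + errD T B k = T.d k := by simp [errD]
  have hdn : 0 < ‖T.d k‖ := norm_pos_iff.2 (hT.d_ne_zero hP k)
  have hxa : T.xAt k a ∈ X := by
    have h1 : T.x k + (a / T.αmax k) • (T.αmax k • (T.d k).fst) ∈ X :=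
      hData.convex.add_smul_mem (hData.iterate_mem k) (hData.trial_mem k)
        ⟨by positivity, (div_le_one hpos).2 haα2⟩
    rwa [smul_smul, div_mul_cancel₀ _ hpos.ne'] at h1
  have hdesc := exact_merit_descent hP hData.isOpen hData.convex hData.f_diff hData.c_diff
    hData.g_lip hData.J_lip (d := T.d k) (hT.slack_pos hP k) ha.le
    (haα2.trans (hT.boundary k).1.2.1) hτ (hData.iterate_mem k) hxa
    (hT.slackAt_ge hP (hT.slack_pos hP k) ha.le haα2)
  have hn1 := abs_merit_sub_le O Ob (μ := P.μ) hτ (T.slackAt k a) (hData.f_noise _ hxa)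
    (hData.c_noise _ hxa)
  have hn2 := abs_merit_sub_le O Ob (μ := P.μ) hτ (T.s k) (hData.f_noise _ (hData.iterate_mem k))
    (hData.c_noise _ (hData.iterate_mem k))
  have hξ : 0 < ξ₀ P Lg LJ (T.τ k) := by
    have := hData.Lg_pos
    have := hData.LJ_pos
    exact lt_max_of_lt_left (by positivity)
  set M := statMeas Ob P T B k (B.τ k) with hMdef
  have hstep : ξ₀ P Lg LJ (T.τ k) * a * ‖T.d k‖ ^ 2 ≤ (1 - P.ηφ) * M / 2 := by
    rw [hd, le_div_iff₀ (by positivity)] at haα1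
    linarith
  have hM' : P.ηφ * E₁ Ob O P T B k - (1 - P.ηφ) * E₂ Ob P T B k ≤ (1 - P.ηφ) * M / 2 := by
    rw [div_le_iff₀ h1η] at hM
    linarith
  have hr1 := modelRed_eq_statMeas_add_E₂ Ob P T B k
  have hr2 := modelRed_eq_modelRed_add_E₁ Ob O P T B k
  -- The budget (1 - ηφ)M is spent half on the quadratic term and half on the model errors.
  have hkey : a * (-(Ob.modelRed P.μ (T.x k) (T.s k) (T.d k) (T.τ k))
      + ξ₀ P Lg LJ (T.τ k) * a * ‖T.d k‖ ^ 2)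
      ≤ a * (-(P.ηφ * O.modelRed P.μ (T.x k) (T.s k) (T.d k) (T.τ k))) := by
    gcongr
    rw [hr2, hr1]
    linarith
  -- Noise at the two end points uses 2ε_k of the relaxation; the ζ part is spare.
  have hε : 0 ≤ P.ζ * T.ε P k := by
    have := hP.ζ_pos
    have := hP.εf_pos
    have := hP.εc_pos
    rw [Trace.ε]
    positivity
  change O.merit P.μ (T.xAt k a) (T.slackAt k a) (T.τ k) ≤ _
  change Ob.merit P.μ (T.xAt k a) (T.slackAt k a) (T.τ k) ≤ _ at hdesc
  have hεdef : T.ε P k = T.τ k * P.εf + P.εc := rfl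
  have j1 := (abs_le.1 hn1).1
  have j2 := (abs_le.1 hn2).2
  rw [← hεdef] at j1 j2
  linarith

/-- If the exact model reduction exceeds its noise-dependent threshold, then the merit function
decreases by at least a fixed amount. -/
theorem merit_decrease (hP : P.Admissible) (hT : IsInfiniteRun O P T)
    (hData : RegularData fbar cbar O P εg εJ X Lg LJ T) {k : ℕ} (hτ : 0 < T.τ k)
    (hM0 : 0 ≤ statMeas (exactOracle fbar cbar) P T B k (B.τ k))
    (hM : max (max
          (2 * (P.ηφ * E₁ (exactOracle fbar cbar) O P T B k
              - (1 - P.ηφ) * E₂ (exactOracle fbar cbar) P T B k) / (1 - P.ηφ))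
          (-2 * Em (exactOracle fbar cbar) O P T B k))
          (4 * (4 + 2 * P.ζ) * T.ε P k / (αhat (exactOracle fbar cbar) P T B k Lg LJ * P.ηφ))
      < statMeas (exactOracle fbar cbar) P T B k (B.τ k)) :
    O.merit P.μ (T.x (k + 1)) (T.s (k + 1)) (T.τ k)
      ≤ O.merit P.μ (T.x k) (T.s k) (T.τ k) - P.εc := by
  set Ob := exactOracle fbar cbar
  obtain ⟨hM12, hM3⟩ := max_lt_iff.1 hM
  obtain ⟨hM1, hM2⟩ := max_lt_iff.1 hM12
  have hη := hP.ηφ_mem.1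
  have h1η : 0 < 1 - P.ηφ := by linarith [hP.ηφ_mem.2]
  have hpos := hT.αmax_pos k
  have hεf := hP.εf_pos
  have hεc := hP.εc_pos
  have hζ := hP.ζ_pos
  have hε : P.εc ≤ T.ε P k := by
    rw [Trace.ε]
    have : 0 < T.τ k * P.εf := by positivity
    linarith
  have hξ : 0 < ξ₀ P Lg LJ (T.τ k) := by
    have := hData.Lg_pos
    have := hData.LJ_pos
    exact lt_max_of_lt_left (by positivity)
  have hd : B.d k + errD T B k = T.d k := by simp [errD]
  have hdn : 0 < ‖T.d k‖ := norm_pos_iff.2 (hT.d_ne_zero hP k)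
  have hα0 : 0 ≤ αhat Ob P T B k Lg LJ := le_min (by positivity) hpos.le
  -- Nonnegativity of `αhat` already makes the third threshold nonnegative; the resulting M > 0 then
  -- makes `αhat` positive.
  have hMpos : 0 < statMeas Ob P T B k (B.τ k) := by
    refine lt_of_le_of_lt ?_ hM3
    have : 0 ≤ T.ε P k := hεc.le.trans hε
    positivity
  have hα : 0 < αhat Ob P T B k Lg LJ := by
    refine lt_min ?_ hpos
    rw [hd]
    positivity
  have hhalf := hT.half_le_α (min_le_right _ _)
    (fun b hb hb' => armijo_of_le_αhat hP hT hData hτ hM1.le hb hb')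
  have hmerit := hT.merit_succ_le hP hτ
  have hred : O.modelRed P.μ (T.x k) (T.s k) (T.d k) (T.τ k)
      = statMeas Ob P T B k (B.τ k) + Em Ob O P T B k := by
    rw [modelRed_eq_modelRed_add_E₁ Ob, modelRed_eq_statMeas_add_E₂, Em]
    ring
  set M := statMeas Ob P T B k (B.τ k)
  set m := O.modelRed P.μ (T.x k) (T.s k) (T.d k) (T.τ k)
  have hm : M / 2 ≤ m := by linarith
  -- The factor 4 in the third threshold pays for two halvings, of the step size and of the model
  -- reduction.
  have hkey : (4 + 2 * P.ζ) * T.ε P k ≤ P.ηφ * T.α k * m := by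
    rw [div_lt_iff₀ (by positivity)] at hM3
    calc (4 + 2 * P.ζ) * T.ε P k ≤ P.ηφ * (αhat Ob P T B k Lg LJ / 2) * (M / 2) := by linarith
      _ ≤ P.ηφ * T.α k * m := by
        have := (hT.α_mem k).1
        gcongr
        exact hhalf
  have : 0 ≤ (1 + P.ζ) * T.ε P k := mul_nonneg (by linarith) (by linarith)
  linarith

/-- Arbitrarily late in the run the exact model reduction is below its threshold. -/
theorem exists_statMeas_le (hP : P.Admissible) (hT : IsInfiniteRun O P T)
    (hB : IsShadow (exactOracle fbar cbar) P T B)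
    (hData : RegularData fbar cbar O P εg εJ X Lg LJ T)
    (hW : WellBehavedW (exactOracle fbar cbar) O P T B) (hs : BoundedSlacks T) (N : ℕ) :
    ∃ k, N ≤ k ∧ statMeas (exactOracle fbar cbar) P T B k (B.τ k) ≤
      max (max
          (2 * (P.ηφ * E₁ (exactOracle fbar cbar) O P T B k
              - (1 - P.ηφ) * E₂ (exactOracle fbar cbar) P T B k) / (1 - P.ηφ))
          (-2 * Em (exactOracle fbar cbar) O P T B k))
          (4 * (4 + 2 * P.ζ) * T.ε P k
            / (αhat (exactOracle fbar cbar) P T B k Lg LJ * P.ηφ)) := by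
  by_contra! hcon
  obtain ⟨σW, hσ, hpd⟩ := hW.pos_def
  have hτ := hT.isShadow.τ_pos hP hσ fun k w hw => hpd k w (Or.inl hw)
  have hanti := hT.isShadow.τ_antitone hP hσ fun k w hw => hpd k w (Or.inl hw)
  have hM0 := hB.modelRed_nonneg hP hσ fun k w hw => hpd k w (Or.inr hw)
  obtain ⟨b, hb, hsb⟩ := hs
  obtain ⟨finf, hf⟩ := hData.f_bdd
  have hobj : ∃ l, ∀ k, l ≤ O.obj P.μ (T.x k) (T.s k) := by
    refine ⟨finf - P.εf - P.μ * (q * b), fun k => ?_⟩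
    have h1 := hf _ (hData.iterate_mem k)
    have h2 := (abs_le.1 (hData.f_noise _ (hData.iterate_mem k))).2
    have h3 : ∑ i, Real.log (T.s k i) ≤ q * b := by
      calc ∑ i, Real.log (T.s k i) ≤ ∑ _i : Fin q, b := by
            refine Finset.sum_le_sum fun i _ => ?_
            have h4 := Real.log_le_sub_one_of_pos (hT.slack_pos hP k i)
            have h5 := (PiLp.norm_apply_le (T.s k) i).trans (hsb k)
            have h6 := (le_abs_self (T.s k i)).trans h5
            linarith
        _ = q * b := by simp
    have h4 := mul_le_mul_of_nonneg_left h3 hP.μ_pos.le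
    rw [Oracle.obj]
    linarith
  obtain ⟨l, hl⟩ := hobj
  -- Subtracting `l` makes the factor of τ_k nonnegative, so a decrease of the merit parameter
  -- cannot raise `Φ`.
  set Φ : ℕ → ℝ := fun k =>
    T.τ k * (O.obj P.μ (T.x k) (T.s k) - l) + ‖O.con (T.x k) (T.s k)‖ with hΦ
  have hΦ0 : ∀ k, 0 ≤ Φ k := fun k =>
    add_nonneg (mul_nonneg (hτ k).le (sub_nonneg.2 (hl k))) (norm_nonneg _)
  have hstep : ∀ k, N ≤ k → Φ (k + 1) ≤ Φ k - P.εc := by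
    intro k hk
    have h1 := merit_decrease hP hT hData (hτ k) (hM0 k) (hcon k hk)
    have h2 : T.τ (k + 1) * (O.obj P.μ (T.x (k + 1)) (T.s (k + 1)) - l)
        ≤ T.τ k * (O.obj P.μ (T.x (k + 1)) (T.s (k + 1)) - l) :=
      mul_le_mul_of_nonneg_right (hanti (Nat.le_succ k)) (sub_nonneg.2 (hl _))
    simp only [Oracle.merit] at h1
    simp only [hΦ]
    linarith
  have hiter : ∀ j : ℕ, Φ (N + j) ≤ Φ N - j * P.εc := by
    intro j
    induction j with
    | zero => simp
    | succ j ih =>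
      have := hstep (N + j) (Nat.le_add_right _ _)
      rw [← add_assoc]
      push_cast
      linarith
  obtain ⟨j, hj⟩ := exists_nat_gt (Φ N / P.εc)
  rw [div_lt_iff₀ hP.εc_pos] at hj
  linarith [hiter j, hΦ0 (N + j)]

theorem exists_valid_consts (hP : P.Admissible) (hT : IsInfiniteRun O P T)
    (hB : IsShadow (exactOracle fbar cbar) P T B)
    (hData : RegularData fbar cbar O P εg εJ X Lg LJ T)
    (hW : WellBehavedW (exactOracle fbar cbar) O P T B) (hs : BoundedSlacks T) {kJ : ℕ} {γ : ℝ}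
    (hγ : SingularValuesAbove O εJ T kJ γ) :
    ∃ C : Consts, C.Valid (exactOracle fbar cbar) P T B kJ := by
  set Ob := exactOracle fbar cbar
  obtain ⟨σW, hσ, hpd⟩ := hW.pos_def
  obtain ⟨κW, -, hκ⟩ := hW.bdd
  obtain ⟨Cc, G, K, hQ⟩ := exists_traceBounds (Q := Ob) (P := P) hData.iterate_mem hs hData.c_bdd
    hData.g_bdd hData.J_bdd hσ (fun k w hw => hpd k w (Or.inr hw)) hκ
  obtain ⟨Cc', G', K', hQ'⟩ := exists_traceBounds (Q := O) (P := P) hData.iterate_mem hs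
    (bounded_of_near hData.c_bdd hData.c_noise) (bounded_of_near hData.g_bdd hData.g_noise)
    (bounded_of_near hData.J_bdd hData.J_noise) hσ (fun k w hw => hpd k w (Or.inl hw)) hκ
  -- Perturbing the noisy Jacobian by at most `εJ` leaves the positive bound `γ - εJ` for the
  -- noiseless one.
  have hfull : ∀ k, kJ ≤ k → ∀ y, (γ - εJ) * ‖y‖ ≤ ‖(Ob.jac (T.x k) (T.s k)).adjoint y‖ := by
    intro k hk y
    have h1 := mul_norm_le_norm_adjoint_of_le_sigmaMin (hData.εJ_pos.trans hγ.1) (hγ.2 k hk)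
      finrank_vec_le_finrank_pvec y
    have h2 : ‖(Ob.jac (T.x k) (T.s k) - O.jac (T.x k) (T.s k)).adjoint y‖ ≤ εJ * ‖y‖ := by
      refine ContinuousLinearMap.le_of_opNorm_le _ ?_ y
      rw [norm_adjoint_eq]
      exact (Oracle.norm_jac_sub_le _ _ _ _).trans (hData.J_noise _ (hData.iterate_mem k))
    rw [map_sub, sub_apply] at h2
    have h3 := norm_sub_norm_le ((O.jac (T.x k) (T.s k)).adjoint y)
      ((Ob.jac (T.x k) (T.s k)).adjoint y)
    rw [norm_sub_rev] at h3
    linarith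
  obtain ⟨M, hM⟩ := hB.τ_eventually_const hP hQ (sub_pos.2 hγ.1) hfull
  have hpos := hB.τ_pos hP hσ hQ.pos_def
  have hanti := hB.τ_antitone hP hσ hQ.pos_def
  obtain ⟨ξ, hξ, hξle⟩ := hB.exists_modelRed_lower hP hQ (hpos M) fun k => by
    rcases le_total k M with h | h
    · exact hanti h
    · exact (hM k h).ge
  have hd := hB.norm_d_le hP hQ
  have hd' := hT.isShadow.norm_d_le hP hQ'
  have hG : 0 ≤ G := (norm_nonneg _).trans (hQ.grad_le 0)
  have hK : 0 ≤ K := (norm_nonneg _).trans (hQ.jac_le 0)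
  -- Both steps are bounded separately, and the sum of the two bounds serves as ε_d.
  have hdd := fun k => (norm_sub_le (T.d k) (B.d k)).trans (add_le_add (hd' k) (hd k))
  exact ⟨⟨M, B.τ M, ξ, _, G + 1, K + 1⟩,
    { τlim_pos := hpos M
      τ_eventually := hM
      ξd_pos := hξ
      ξd_le := hξle
      εd_nonneg := (norm_nonneg _).trans (hdd 0)
      εd_bound := fun k _ => hdd k
      gsup_pos := by positivity
      g_bound := fun k => (hQ.grad_le k).trans (by linarith)
      Jsup_pos := by positivity
      J_bound := fun k => (hQ.jac_le k).trans (by linarith) }⟩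

/-- Combining ‖d‖² ≤ 2‖d̄‖² + 2ε_d² with ξ_d‖d̄‖² ≤ M removes the step from the denominator and
turns its factor 2 into 4. -/
theorem αbar_le_αhat {Obar : Oracle n q} {C : Consts} {k kJ : ℕ} (hP : P.Admissible)
    (hC : C.Valid Obar P T B kJ) (hkτ : C.kτ ≤ k) (hkJ : kJ ≤ k) (hd0 : 0 < ‖T.d k‖)
    (hξ : 0 < ξ₀ P Lg LJ (T.τ k)) (hM : 0 < statMeas Obar P T B k C.τlim) :
    αbar Obar P Lg LJ T B C k ≤ αhat Obar P T B k Lg LJ := by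
  have hd : B.d k + errD T B k = T.d k := by simp [errD]
  have hτ := hC.τ_eventually k hkτ
  have h1 := hC.ξd_le k
  have hξd := hC.ξd_pos
  have h1η : 0 < 1 - P.ηφ := by linarith [hP.ηφ_mem.2]
  refine min_le_min_right _ ?_
  rw [hd, hτ]
  rw [hτ] at h1
  set M := statMeas Obar P T B k C.τlim
  have h2 : ‖T.d k‖ ≤ ‖B.d k‖ + C.εd := by
    have h3 := norm_add_le (B.d k) (T.d k - B.d k)
    rw [add_sub_cancel] at h3
    linarith [hC.εd_bound k hkJ]
  have h3 : ‖T.d k‖ ^ 2 ≤ 2 * ‖B.d k‖ ^ 2 + 2 * C.εd ^ 2 := by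
    have := pow_le_pow_left₀ (norm_nonneg _) h2 2
    nlinarith [sq_nonneg (‖B.d k‖ - C.εd)]
  have h4 : C.ξd * ‖T.d k‖ ^ 2 ≤ 2 * (M + C.ξd * C.εd ^ 2) := by
    have := mul_le_mul_of_nonneg_left h3 hξd.le
    linarith
  rw [div_le_div_iff₀ (by positivity) (by positivity)]
  calc (1 - P.ηφ) * C.ξd * M * (2 * ξ₀ P Lg LJ (T.τ k) * ‖T.d k‖ ^ 2)
      = (1 - P.ηφ) * M * (2 * ξ₀ P Lg LJ (T.τ k)) * (C.ξd * ‖T.d k‖ ^ 2) := by ring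
    _ ≤ (1 - P.ηφ) * M * (2 * ξ₀ P Lg LJ (T.τ k)) * (2 * (M + C.ξd * C.εd ^ 2)) := by gcongr
    _ = _ := by ring

/-- The iteration-dependent thresholds are bounded by `ρ_{k,1}`, `ρ_{k,2}` and `ρ_{k,3}`. -/
theorem statMeas_le_max_ρ (hP : P.Admissible) (hT : IsInfiniteRun O P T)
    (hB : IsShadow (exactOracle fbar cbar) P T B)
    (hData : RegularData fbar cbar O P εg εJ X Lg LJ T)
    (hW : WellBehavedW (exactOracle fbar cbar) O P T B) {kJ k : ℕ} {C : Consts}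
    (hC : C.Valid (exactOracle fbar cbar) P T B kJ) (hkτ : C.kτ ≤ k) (hkJ : kJ ≤ k)
    (h : statMeas (exactOracle fbar cbar) P T B k (B.τ k) ≤
      max (max
          (2 * (P.ηφ * E₁ (exactOracle fbar cbar) O P T B k
              - (1 - P.ηφ) * E₂ (exactOracle fbar cbar) P T B k) / (1 - P.ηφ))
          (-2 * Em (exactOracle fbar cbar) O P T B k))
          (4 * (4 + 2 * P.ζ) * T.ε P k
            / (αhat (exactOracle fbar cbar) P T B k Lg LJ * P.ηφ))) :
    statMeas (exactOracle fbar cbar) P T B k C.τlim ≤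
      max (max (ρ₁ (exactOracle fbar cbar) P εg εJ T B C k)
        (ρ₂ (exactOracle fbar cbar) P εg εJ T B C k))
        (ρ₃ (exactOracle fbar cbar) P Lg LJ T B C k) := by
  set Ob := exactOracle fbar cbar
  obtain ⟨σW, hσ, hpd⟩ := hW.pos_def
  have hpd1 := fun k w hw => hpd k w (Or.inl hw)
  have hpd2 := fun k w hw => hpd k w (Or.inr hw)
  have hτ := hT.isShadow.τ_pos hP hσ hpd1
  have hτ0 := hT.isShadow.τ_antitone hP hσ hpd1 (Nat.zero_le k)
  have hBτ := hB.τ_pos hP hσ hpd2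
  have hBτ0 := hB.τ_antitone hP hσ hpd2 (Nat.zero_le k)
  have hM0 : 0 ≤ statMeas Ob P T B k (B.τ k) := hB.modelRed_nonneg hP hσ hpd2 k
  have hx := hData.iterate_mem k
  have hη := hP.ηφ_mem.1
  have h1η : 0 < 1 - P.ηφ := by linarith [hP.ηφ_mem.2]
  have hεc := hP.εc_pos
  have hεf := hP.εf_pos
  have hζ := hP.ζ_pos
  have hεg := hData.εg_pos
  have hεJ := hData.εJ_pos
  have hξd := hC.ξd_pos
  have hg1 : ‖errG Ob O P T k‖ ≤ εg := by
    refine (Oracle.norm_grad_sub_le _ _ _ _).trans ?_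
    rw [norm_sub_rev]
    exact hData.g_noise _ hx
  have hc1 : ‖errC Ob O T k‖ ≤ P.εc := by
    rw [errC, Oracle.con_sub, norm_sub_rev]
    exact hData.c_noise _ hx
  have hJ1 : ‖errJ Ob O T k‖ ≤ εJ := by
    refine (Oracle.norm_jac_sub_le _ _ _ _).trans ?_
    rw [norm_sub_rev]
    exact hData.J_noise _ hx
  have hE1 := abs_E₁_le (B := B) (hτ k) hτ0 hg1 hc1 hJ1
  have hE2 := abs_E₂_le (hτ k) hτ0 (hBτ k) hBτ0 (hC.g_bound k) (hC.J_bound k) (hC.εd_bound k hkJ)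
  have hξle := hC.ξd_le k
  rw [hC.τ_eventually k hkτ] at h hM0 hξle
  set M := statMeas Ob P T B k C.τlim with hMdef
  -- This is the source of the square root in ρ₁ and ρ₂: the step is bounded by the quantity being
  -- estimated.
  have hdM : ‖B.d k‖ ≤ 1 / √C.ξd * √M := by
    rw [one_div, inv_mul_eq_div, ← Real.sqrt_div hM0]
    refine Real.le_sqrt_of_sq_le ?_
    rw [le_div_iff₀ hξd]
    linarith
  have hTd : ‖T.d k‖ ≤ ‖B.d k‖ + C.εd := by
    have h3 := norm_add_le (B.d k) (T.d k - B.d k)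
    rw [add_sub_cancel] at h3
    linarith [hC.εd_bound k hkJ]
  have hT0 : 0 < T.τ 0 := hτ 0
  have hgs := hC.gsup_pos
  have hE1' : |E₁ Ob O P T B k| ≤ e₁ P εg εJ T C + e₂ εg εJ T * (1 / √C.ξd * √M) := by
    refine hE1.trans ?_
    have h5 : (T.τ 0 * εg + εJ) * ‖T.d k‖ ≤ (T.τ 0 * εg + εJ) * (1 / √C.ξd * √M + C.εd) := by
      gcongr
      linarith
    rw [e₁, e₂]
    linarith
  have hE2' : |E₂ Ob P T B k| ≤ c₁ T C + c₂ T B C * (1 / √C.ξd * √M) := by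
    refine hE2.trans ?_
    rw [c₁, c₂]
    have hmax : 0 ≤ max (T.τ 0) (B.τ 0) := hT0.le.trans (le_max_left _ _)
    gcongr
  rcases le_max_iff.1 h with h12 | h3
  · refine le_max_of_le_left ?_
    rcases le_max_iff.1 h12 with h1 | h2
    · refine le_max_of_le_left (h1.trans ?_)
      have h6 : 2 * (P.ηφ * E₁ Ob O P T B k - (1 - P.ηφ) * E₂ Ob P T B k) / (1 - P.ηφ)
          = 2 * (P.ηφ / (1 - P.ηφ) * E₁ Ob O P T B k - E₂ Ob P T B k) := by
        field_simp
      have h7 : P.ηφ / (1 - P.ηφ) * E₁ Ob O P T B k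
          ≤ P.ηφ / (1 - P.ηφ) * (e₁ P εg εJ T C + e₂ εg εJ T * (1 / √C.ξd * √M)) := by
        gcongr
        exact (le_abs_self _).trans hE1'
      rw [h6, ρ₁, ← hMdef]
      linarith [(abs_le.1 hE2').1]
    · refine le_max_of_le_right (h2.trans ?_)
      rw [ρ₂, Em, ← hMdef]
      linarith [(abs_le.1 hE2').1, (abs_le.1 hE1').1]
  · refine le_max_of_le_right ?_
    rw [ρ₃]
    have hε : 0 ≤ T.ε P k := by
      have := hτ k
      rw [Trace.ε]
      positivity
    have hpos := hT.αmax_pos k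
    have hξ : 0 < ξ₀ P Lg LJ (T.τ k) := by
      have := hτ k
      have := hData.Lg_pos
      have := hData.LJ_pos
      exact lt_max_of_lt_left (by positivity)
    -- If M = 0 it suffices that ρ₃ ≥ 0; otherwise `αbar` is positive and replacing `αhat` by it
    -- enlarges the quotient.
    rcases hM0.eq_or_lt with h0 | h0
    · have h8 : 0 ≤ αbar Ob P Lg LJ T B C k := by
        rw [αbar, ← hMdef]
        exact le_min (by positivity) hpos.le
      rw [← h0]
      positivity
    · have h8 : 0 < αbar Ob P Lg LJ T B C k := by
        rw [αbar, ← hMdef]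
        exact lt_min (by positivity) hpos
      have h9 := αbar_le_αhat (Lg := Lg) (LJ := LJ) hP hC hkτ hkJ
        (norm_pos_iff.2 (hT.d_ne_zero hP k)) hξ h0
      refine h3.trans ?_
      gcongr

end Main

end NoisyIP

theorem mainTheorem1 {n q : ℕ} (fbar : NoisyIP.Vec n → ℝ)
    (cbar : NoisyIP.Vec n → NoisyIP.Vec q) (O : NoisyIP.Oracle n q) (P : NoisyIP.Params)
    (hP : P.Admissible) (T : NoisyIP.Trace n q) (hT : NoisyIP.IsInfiniteRun O P T)
    (B : NoisyIP.Shadow n q) (hB : NoisyIP.IsShadow (NoisyIP.exactOracle fbar cbar) P T B)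
    (εg εJ : ℝ) (X : Set (NoisyIP.Vec n)) (Lg LJ : ℝ)
    (hData : NoisyIP.RegularData fbar cbar O P εg εJ X Lg LJ T)
    (hW : NoisyIP.WellBehavedW (NoisyIP.exactOracle fbar cbar) O P T B)
    (hs : NoisyIP.BoundedSlacks T) :
    (∃ k : ℕ,
      NoisyIP.statMeas (NoisyIP.exactOracle fbar cbar) P T B k (B.τ k) ≤
        max (max
          (2 * (P.ηφ * NoisyIP.E₁ (NoisyIP.exactOracle fbar cbar) O P T B k
              - (1 - P.ηφ) * NoisyIP.E₂ (NoisyIP.exactOracle fbar cbar) P T B k) / (1 - P.ηφ))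
          (-2 * NoisyIP.Em (NoisyIP.exactOracle fbar cbar) O P T B k))
          (4 * (4 + 2 * P.ζ) * T.ε P k
            / (NoisyIP.αhat (NoisyIP.exactOracle fbar cbar) P T B k Lg LJ * P.ηφ))) ∧
    (∀ (kJ : ℕ) (γ : ℝ), NoisyIP.SingularValuesAbove O εJ T kJ γ →
      NoisyIP.NoiseLevel (NoisyIP.exactOracle fbar cbar) O εJ T kJ →
        (∃ C : NoisyIP.Consts, C.Valid (NoisyIP.exactOracle fbar cbar) P T B kJ) ∧
        ∀ C : NoisyIP.Consts, C.Valid (NoisyIP.exactOracle fbar cbar) P T B kJ →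
          ∃ k : ℕ, C.kτ ≤ k ∧
            NoisyIP.statMeas (NoisyIP.exactOracle fbar cbar) P T B k C.τlim ≤
              max (max (NoisyIP.ρ₁ (NoisyIP.exactOracle fbar cbar) P εg εJ T B C k)
                (NoisyIP.ρ₂ (NoisyIP.exactOracle fbar cbar) P εg εJ T B C k))
                (NoisyIP.ρ₃ (NoisyIP.exactOracle fbar cbar) P Lg LJ T B C k)) := by
  refine ⟨?_, fun kJ γ hγ _ =>
    ⟨NoisyIP.exists_valid_consts hP hT hB hData hW hs hγ, fun C hC => ?_⟩⟩
  · obtain ⟨k, -, hk⟩ := NoisyIP.exists_statMeas_le hP hT hB hData hW hs 0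
    exact ⟨k, hk⟩
  -- Beyond this index τ̄_k is constant and the bound on d_k - d̄_k is available.
  · obtain ⟨k, hk, hle⟩ := NoisyIP.exists_statMeas_le hP hT hB hData hW hs (max C.kτ kJ)
    have hkτ := (le_max_left _ _).trans hk
    have hkJ := (le_max_right _ _).trans hk
    exact ⟨k, hkτ, NoisyIP.statMeas_le_max_ρ hP hT hB hData hW hC hkτ hkJ hle⟩
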